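/- Let $M$ be a (Hausdorff, finite-dimensional) complex manifold, let $E_0,\dots,E_k\to M$ be holomorphic vector bundles of positive rank, and let $E=E_0\oplus\cdots\oplus E_k$. Let $0=\beta_0<\beta_1<\cdots<\beta_k$ be integers, let $\mathbb C^*$ act on $E$ by $\lambda*(v_0,\dots,v_k)=(\lambda^{\beta_0}v_0,\dots,\lambda^{\beta_k}v_k)$, and consider the induced action on the bundle $\mathbb P(E)\to M$ of lines in $E$. Let $s:M\to\mathbb P(E)$ be a holomorphic section. *The strict transform $\tilde S$.* The blow-up of the bihomogeneous ideal $$\mathcal I=\langle \mu^{\beta_k}v_0,\ \mu^{\beta_k-\beta_1}\lambda^{\beta_1}v_1,\ \dots,\ \mu^{\beta_k-\beta_{k-1}}\lambda^{\beta_{k-1}}v_{k-1},\ \lambda^{\beta_k}v_k\rangle$$ on $\mathbb P^1\times\mathbb P(E)$, with coordinates $([\mu:\lambda],[v])$, is the closure in $\mathbb P^1\times\mathbb P(E)\times_M\mathbb P(E)$ of the graph of the map to $\mathbb P(E)$ given by these generators off their common zero locus. The strict transform $\tilde S$ of $\mathbb P^1\times s(M)$ is the closure of the part of this graph lying over $\mathbb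 P^1\times s(M)$. *The sets attached to $F_i$.* Fix $0\le i\le k$ and put $F_i=\mathbb P(E_i)$, $E_i'=\bigoplus_{j\ne i}E_j$, $$S(F_i)=\{[v_0:\cdots:v_i:0:\cdots:0]\mid v_i\neq0\},\qquad U(F_i)=\{[0:\cdots:0:v_i:\cdots:v_k]\mid v_i\neq0\},$$ with the projections $[v]\mapsto[v_i]$ to $F_i$, and $$C_i^\infty=\{([w],[v])\in\mathbb P(E_{\le i})\times_M\mathbb P(E_{\ge i})\mid w_i\wedge v_i=0\},\qquad \tilde S_i^\infty=\pi_{2,3}\bigl(\tilde S\cap(\{[0:1]\}\times C_i^\infty)\bigr),$$ where $\pi_{2,3}$ is the projection from $\mathbb P^1\times\mathbb P(E)\times_M\mathbb P(E)$ to $\mathbb P(E)\times_M\mathbb P(E)$. *The weighted strict transform and its affine cone.* Let $\tau_i\to\mathbb P(E_i)$ be the tautological line bundle and $\pi_i:\mathbb P(E_i)\to M$ the projection. The map $(\ell,T:\ell\to E_i')\mapsto\operatorname{graph}(T)\subset E$ is a chart $\mathrm{Hom}(\tau_i,\pi_i^*E_i')\cong\mathbb P(E)\setminus\mathbb P(E_i')$.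 Let $A\subset\mathrm{Hom}(\tau_i,\pi_i^*E_i')$ correspond to $s(M)\cap(\mathbb P(E)\setminus\mathbb P(E_i'))$. Write points of $\mathrm{Hom}(\tau_i,\pi_i^*E_i')$ as $v=(v_{<i},v_{>i})$, and let $\mathbb P^{\beta_{>i}}(\mathrm{Hom}(\tau_i,\pi_i^*E_{>i}))$ be the bundle over $\mathbb P(E_i)$ of weighted projective spaces with weights $\beta_j-\beta_i$, $j>i$. The weighted strict transform of $A$ in the weighted blow-up of $S(F_i)$ (that is, of $v_{>i}=0$) is the closure $$\mathrm{Bl}(A)=\overline{\{(v,[v_{>i}])\mid v\in A,\ v_{>i}\ne0\}}\subset\mathrm{Hom}(\tau_i,\pi_i^*E_i')\times_{\mathbb P(E_i)}\mathbb P^{\beta_{>i}}(\mathrm{Hom}(\tau_i,\pi_i^*E_{>i})).$$ Its affine cone over $A$ is the set of all $(v,w)$ in $\mathrm{Hom}(\tau_i,\pi_i^*E_i')\times_{\mathbb P(E_i)}\mathrm{Hom}(\tau_i,\pi_i^*E_{>i})$ with $v\in A$ and either $w=0$ or $(v,[w])\in\mathrm{Bl}(A)$. The exceptional divisor of the affine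 cone is the part of it with $v_{>i}=0$. Let $(EG_1^A)_i\subset\mathbb P(E)\times_M\mathbb P(E)$ be its image under the product of the chart with itself. **Theorem.** For every $0\le i\le k$ the set $S(F_i)\times_{F_i}U(F_i)$ is open and dense in $C_i^\infty$, and the following equalities of sets hold: $$\tilde S\cap\bigl(\{[0:1]\}\times (S(F_i)\times_{F_i}U(F_i))\bigr)=\{[0:1]\}\times(EG_1^A)_i,$$ $$\tilde S_i^\infty\cap\bigl((\mathbb P(E)\setminus\mathbb P(E_i'))\times_M(\mathbb P(E)\setminus\mathbb P(E_i'))\bigr)=(EG_1^A)_i .$$ -/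

import Mathlib

open scoped LinearAlgebra.Projectivization ContDiff Manifold Topology
open Bundle

noncomputable section

namespace WeightedBlowup

/-- The quotient topology on the projective line `ℙ¹`. -/
instance instTopologicalSpaceP1 : TopologicalSpace (ℙ ℂ (Fin 2 → ℂ)) :=
  TopologicalSpace.coinduced (Projectivization.mk' ℂ) inferInstance

/-- The point `[μ : λ] = [0 : 1]` of `ℙ¹`. -/
def infinityP1 : ℙ ℂ (Fin 2 → ℂ) :=
  Projectivization.mk ℂ ![0, 1] (fun h => one_ne_zero (congrFun h 1))

section Bundles

variable {k : ℕ} {M : Type*} (F : Fin (k + 1) → Type*) (E : Fin (k + 1) → M → Type*)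
  [∀ j m, AddCommGroup (E j m)] [∀ j m, Module ℂ (E j m)]

/-- The fibre over `m` of the direct sum `E = E_0 ⊕ ⋯ ⊕ E_k`. -/
abbrev Fib (m : M) : Type _ := ∀ j, E j m

/-- The total space of the projective bundle `ℙ(E) → M` of lines in `E = E_0 ⊕ ⋯ ⊕ E_k`.
The model fibres `F` only serve to find the topology, as in `Bundle.TotalSpace`. -/
@[ext]
structure PE (F : Fin (k + 1) → Type*) (E : Fin (k + 1) → M → Type*)
    [∀ j m, AddCommGroup (E j m)] [∀ j m, Module ℂ (E j m)] where
  base : M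
  line : ℙ ℂ (Fib E base)

/-- The complement of the zero section in the total space of `E = E_0 ⊕ ⋯ ⊕ E_k`. -/
structure NonzeroVec (F : Fin (k + 1) → Type*) (E : Fin (k + 1) → M → Type*)
    [∀ j m, AddCommGroup (E j m)] where
  base : M
  vec : Fib E base
  ne_zero : vec ≠ 0

variable {F E}

/-- The projection `E ∖ 0 → ℙ(E)`. -/
def NonzeroVec.toPE (z : NonzeroVec F E) : PE F E :=
  ⟨z.base, Projectivization.mk ℂ z.vec z.ne_zero⟩

variable (F E)

/-- `E` is the fibre product over `M` of the bundles `E_j`: its topology is induced by the map to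
the product of their total spaces. -/
instance instTopologicalSpaceNonzeroVec [∀ j, TopologicalSpace (TotalSpace (F j) (E j))] :
    TopologicalSpace (NonzeroVec F E) :=
  TopologicalSpace.induced
    (fun z => fun j => (⟨z.base, z.vec j⟩ : TotalSpace (F j) (E j))) inferInstance

/-- `ℙ(E)` carries the quotient topology of `E ∖ 0`. -/
instance instTopologicalSpacePE [∀ j, TopologicalSpace (TotalSpace (F j) (E j))] :
    TopologicalSpace (PE F E) :=
  TopologicalSpace.coinduced NonzeroVec.toPE inferInstance

/-! ### The blow-up of the bihomogeneous ideal and the strict transform of `ℙ¹ × s(M)` -/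

/-- The generators `(μ^{β_k} v_0, …, μ^{β_k - β_j} λ^{β_j} v_j, …, λ^{β_k} v_k)` of the
bihomogeneous ideal, evaluated at `(μ, λ) = q` and `v`. -/
def idealGen (β : Fin (k + 1) → ℕ) (q : Fin 2 → ℂ) {m : M} (v : Fib E m) : Fib E m :=
  fun j => (q 0 ^ (β (Fin.last k) - β j) * q 1 ^ β j) • v j

/-- The graph in `ℙ¹ × ℙ(E) × ℙ(E)` of the map to `ℙ(E)` given by the generators of the ideal, over
the part of `Z ⊆ ℙ¹ × ℙ(E)` outside of the cosupport (the common zero locus of the generators). -/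
def idealGraph (β : Fin (k + 1) → ℕ) (Z : Set (ℙ ℂ (Fin 2 → ℂ) × PE F E)) :
    Set (ℙ ℂ (Fin 2 → ℂ) × PE F E × PE F E) :=
  {p | ∃ (q : Fin 2 → ℂ) (hq : q ≠ 0) (m : M) (v : Fib E m) (hv : v ≠ 0)
      (hg : idealGen E β q v ≠ 0),
      (Projectivization.mk ℂ q hq, (⟨m, Projectivization.mk ℂ v hv⟩ : PE F E)) ∈ Z ∧
      p = (Projectivization.mk ℂ q hq, ⟨m, Projectivization.mk ℂ v hv⟩,
        ⟨m, Projectivization.mk ℂ (idealGen E β q v) hg⟩)}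

variable [∀ j, TopologicalSpace (TotalSpace (F j) (E j))]

/-- The strict transform of `Z ⊆ ℙ¹ × ℙ(E)` in the blow-up of the ideal. For `Z = univ` this is the
blow-up itself. (`ℙ(E) ×_M ℙ(E)` is closed in `ℙ(E) × ℙ(E)` for Hausdorff `M`, so that the closure
may be taken in the larger space.) -/
def strictTransform (β : Fin (k + 1) → ℕ) (Z : Set (ℙ ℂ (Fin 2 → ℂ) × PE F E)) :
    Set (ℙ ℂ (Fin 2 → ℂ) × PE F E × PE F E) :=
  closure (idealGraph F E β Z)

/-- The image `s(M) ⊆ ℙ(E)` of a section `s`. -/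
def sectionImage (s : ∀ m, ℙ ℂ (Fib E m)) : Set (PE F E) :=
  Set.range fun m => ⟨m, s m⟩

/-- `S̃`, the strict transform of `ℙ¹ × s(M)`. -/
def sTilde (β : Fin (k + 1) → ℕ) (s : ∀ m, ℙ ℂ (Fib E m)) :
    Set (ℙ ℂ (Fin 2 → ℂ) × PE F E × PE F E) :=
  strictTransform F E β (Set.univ ×ˢ sectionImage F E s)

/-- Holomorphic sections of `ℙ(E) → M`: locally they are of the form `m ↦ [σ_0(m) : ⋯ : σ_k(m)]`
with `σ_j` holomorphic sections of `E_j` without common zeros. -/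
def IsHolomorphicSection {EM : Type*} [NormedAddCommGroup EM] [NormedSpace ℂ EM]
    [TopologicalSpace M] [ChartedSpace EM M]
    [∀ j, NormedAddCommGroup (F j)] [∀ j, NormedSpace ℂ (F j)]
    [∀ j m, TopologicalSpace (E j m)]
    [∀ j, FiberBundle (F j) (E j)] (s : ∀ m, ℙ ℂ (Fib E m)) : Prop :=
  ∀ m₀ : M, ∃ U ∈ 𝓝 m₀, ∃ σ : ∀ m, Fib E m,
    (∀ j, ContMDiffOn 𝓘(ℂ, EM) (𝓘(ℂ, EM).prod 𝓘(ℂ, F j)) ω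
      (fun m => (⟨m, σ m j⟩ : TotalSpace (F j) (E j))) U) ∧
    ∀ m ∈ U, ∃ h : σ m ≠ 0, s m = Projectivization.mk ℂ (σ m) h

end Bundles

section Components

variable {k : ℕ} {M : Type*} (F : Fin (k + 1) → Type*) (E : Fin (k + 1) → M → Type*)
  [∀ j m, AddCommGroup (E j m)] [∀ j m, Module ℂ (E j m)]

/-- `C_i^∞`: pairs `([w], [v]) ∈ ℙ(E_{≤ i}) ×_M ℙ(E_{≥ i})` with `w_i ∧ v_i = 0`. -/
def cInfty (i : Fin (k + 1)) : Set (PE F E × PE F E) :=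
  {p | ∃ (m : M) (w v : Fib E m) (hw : w ≠ 0) (hv : v ≠ 0),
      p = (⟨m, Projectivization.mk ℂ w hw⟩, ⟨m, Projectivization.mk ℂ v hv⟩) ∧
      (∀ j, i < j → w j = 0) ∧ (∀ j, j < i → v j = 0) ∧
      ¬ LinearIndependent ℂ ![w i, v i]}

/-- `S(F_i) ×_{F_i} U(F_i)`: pairs `([w_0 : ⋯ : w_i : 0 : ⋯], [0 : ⋯ : v_i : ⋯ : v_k])` with
`w_i ≠ 0`, `v_i ≠ 0` and the same image `[w_i] = [v_i]` in `F_i = ℙ(E_i)`. -/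
def stableUnstable (i : Fin (k + 1)) : Set (PE F E × PE F E) :=
  {p | ∃ (m : M) (w v : Fib E m) (hw : w ≠ 0) (hv : v ≠ 0) (hwi : w i ≠ 0) (hvi : v i ≠ 0),
      p = (⟨m, Projectivization.mk ℂ w hw⟩, ⟨m, Projectivization.mk ℂ v hv⟩) ∧
      (∀ j, i < j → w j = 0) ∧ (∀ j, j < i → v j = 0) ∧
      Projectivization.mk ℂ (w i) hwi = Projectivization.mk ℂ (v i) hvi}

/-- The open set `ℙ(E) ∖ ℙ(E_i')`, where `E_i' = E_{< i} ⊕ E_{> i}`. -/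
def chartDomain (i : Fin (k + 1)) : Set (PE F E) :=
  {x | ∃ (m : M) (v : Fib E m) (hv : v ≠ 0), x = ⟨m, Projectivization.mk ℂ v hv⟩ ∧ v i ≠ 0}

/-- `S̃_i^∞ = π_{2,3}(S̃ ∩ ({[0 : 1]} × C_i^∞))`. -/
def sTildeInfty [∀ j, TopologicalSpace (TotalSpace (F j) (E j))]
    (β : Fin (k + 1) → ℕ) (s : ∀ m, ℙ ℂ (Fib E m)) (i : Fin (k + 1)) :
    Set (PE F E × PE F E) :=
  Prod.snd '' (sTilde F E β s ∩ ({infinityP1} ×ˢ cInfty F E i))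

/-! ### The chart `Hom(τ_i, π_i^* E_i') → ℙ(E) ∖ ℙ(E_i')` -/

/-- The fibre over `m` of `E_i' = E_{< i} ⊕ E_{> i}`, as a subspace of the fibre of `E`. -/
def offFib (i : Fin (k + 1)) (m : M) : Submodule ℂ (Fib E m) where
  carrier := {v | v i = 0}
  zero_mem' := rfl
  add_mem' {v w} hv hw := by
    have h₁ : v i = 0 := hv
    have h₂ : w i = 0 := hw
    simp [h₁, h₂]
  smul_mem' c v hv := by
    have h₁ : v i = 0 := hv
    simp [h₁]

/-- The total space of the vector bundle `Hom(τ_i, π_i^* E_i') → ℙ(E_i)`: a point consists of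
`m ∈ M`, a line `ℓ ⊆ E_{i,m}` and a linear map `ℓ → E'_{i,m}`. -/
structure HomTot (F : Fin (k + 1) → Type*) (E : Fin (k + 1) → M → Type*)
    [∀ j m, AddCommGroup (E j m)] [∀ j m, Module ℂ (E j m)] (i : Fin (k + 1)) where
  base : M
  line : ℙ ℂ (E i base)
  hom : line.submodule →ₗ[ℂ] offFib E i base

variable {F E} {i : Fin (k + 1)}

/-- The vector `u + A u ∈ E_i ⊕ E_i'` for `(ℓ, A) ∈ Hom(τ_i, π_i^* E_i')` and `u ∈ ℓ`. -/
def HomTot.graphVec (x : HomTot F E i) : x.line.submodule →ₗ[ℂ] Fib E x.base :=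
  LinearMap.single ℂ (fun j => E j x.base) i ∘ₗ x.line.submodule.subtype +
    (offFib E i x.base).subtype ∘ₗ x.hom

theorem HomTot.graphVec_apply_self (x : HomTot F E i) (u : x.line.submodule) :
    x.graphVec u i = u := by
  have h : (x.hom u : Fib E x.base) i = 0 := (x.hom u).2
  simp [HomTot.graphVec, h]

theorem HomTot.graphVec_ne_zero (x : HomTot F E i) {u : x.line.submodule} (hu : u ≠ 0) :
    x.graphVec u ≠ 0 := fun h => hu <| Subtype.ext <| by
  rw [← x.graphVec_apply_self u, h]; rfl

/-- A nonzero vector of the line `ℓ`. -/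
def HomTot.gen (x : HomTot F E i) : x.line.submodule :=
  ⟨x.line.rep, by rw [Projectivization.submodule_eq]; exact Submodule.mem_span_singleton_self _⟩

theorem HomTot.gen_ne_zero (x : HomTot F E i) : x.gen ≠ 0 := fun h =>
  x.line.rep_nonzero (congrArg Subtype.val h)

/-- The chart `(ℓ, A) ↦ Γ_A`, the graph of `A : ℓ → E_i'` being a line in `E_i ⊕ E_i' = E`. -/
def HomTot.chart (x : HomTot F E i) : PE F E :=
  ⟨x.base, Projectivization.mk ℂ (x.graphVec x.gen) (x.graphVec_ne_zero x.gen_ne_zero)⟩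

/-- The line `chart (ℓ, A)` is the graph of `A`. -/
theorem HomTot.chart_submodule (x : HomTot F E i) :
    (Projectivization.mk ℂ (x.graphVec x.gen) (x.graphVec_ne_zero x.gen_ne_zero)).submodule =
      LinearMap.range x.graphVec := by
  rw [Projectivization.submodule_mk]
  apply le_antisymm
  · rw [Submodule.span_singleton_le_iff_mem]
    exact ⟨_, rfl⟩
  · rintro _ ⟨u, rfl⟩
    have hu : (u : E i x.base) ∈ Submodule.span ℂ {x.line.rep} := by
      rw [← Projectivization.submodule_eq]; exact u.2
    obtain ⟨c, hc⟩ := Submodule.mem_span_singleton.1 hu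
    have : u = c • x.gen := Subtype.ext hc.symm
    rw [this, map_smul]
    exact Submodule.smul_mem _ _ (Submodule.mem_span_singleton_self _)

/-- The topology of the bundle `Hom(τ_i, π_i^* E_i')`; it is induced by the chart, as the chart is a
homeomorphism onto the open set `ℙ(E) ∖ ℙ(E_i')`. -/
instance instTopologicalSpaceHomTot [∀ j, TopologicalSpace (TotalSpace (F j) (E j))] :
    TopologicalSpace (HomTot F E i) :=
  TopologicalSpace.induced HomTot.chart inferInstance

/-- The bundle projection `Hom(τ_i, π_i^* E_i') → ℙ(E_i)`. -/
def HomTot.proj (x : HomTot F E i) : Σ m, ℙ ℂ (E i m) := ⟨x.base, x.line⟩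

/-- The subbundle `Hom(τ_i, π_i^* E_{< i})`. -/
def homLt (F : Fin (k + 1) → Type*) (E : Fin (k + 1) → M → Type*)
    [∀ j m, AddCommGroup (E j m)] [∀ j m, Module ℂ (E j m)] (i : Fin (k + 1)) :
    Set (HomTot F E i) :=
  {x | ∀ u j, i < j → (x.hom u : Fib E x.base) j = 0}

/-- The subbundle `Hom(τ_i, π_i^* E_{> i})`. -/
def homGt (F : Fin (k + 1) → Type*) (E : Fin (k + 1) → M → Type*)
    [∀ j m, AddCommGroup (E j m)] [∀ j m, Module ℂ (E j m)] (i : Fin (k + 1)) :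
    Set (HomTot F E i) :=
  {x | ∀ u j, j < i → (x.hom u : Fib E x.base) j = 0}

/-- The projection of `E_i' = E_{< i} ⊕ E_{> i}` to `E_{> i}`. -/
def gtMap (E : Fin (k + 1) → M → Type*)
    [∀ j m, AddCommGroup (E j m)] [∀ j m, Module ℂ (E j m)] (i : Fin (k + 1)) (m : M) :
    offFib E i m →ₗ[ℂ] offFib E i m where
  toFun v := ⟨fun j => if i < j then (v : Fib E m) j else 0, if_neg (lt_irrefl i)⟩
  map_add' v w := by
    ext j; by_cases h : i < j <;> simp [h]
  map_smul' c v := by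
    ext j; by_cases h : i < j <;> simp [h]

/-- The weighted action of `c ∈ ℂ^*` on `E_i'`, with weight `β_j - β_i` on `E_j`. -/
def weightMap (E : Fin (k + 1) → M → Type*)
    [∀ j m, AddCommGroup (E j m)] [∀ j m, Module ℂ (E j m)] (β : Fin (k + 1) → ℕ)
    (i : Fin (k + 1)) (m : M) (c : ℂˣ) :
    offFib E i m →ₗ[ℂ] offFib E i m where
  toFun v := ⟨fun j => ((c : ℂ) ^ ((β j : ℤ) - (β i : ℤ))) • (v : Fib E m) j, by
    have h : (v : Fib E m) i = 0 := v.2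
    change _ • (v : Fib E m) i = 0
    rw [h, smul_zero]⟩
  map_add' v w := by
    ext j; simp
  map_smul' a v := by
    ext j; simp [smul_comm a]

/-- The component `(ℓ, A_{> i})` of `(ℓ, A)`. -/
def HomTot.gtPart (x : HomTot F E i) : HomTot F E i :=
  ⟨x.base, x.line, gtMap E i x.base ∘ₗ x.hom⟩

/-- The weighted action of `ℂ^*` on `Hom(τ_i, π_i^* E_i')`. -/
def HomTot.weightedAction (β : Fin (k + 1) → ℕ) (c : ℂˣ) (x : HomTot F E i) : HomTot F E i :=
  ⟨x.base, x.line, weightMap E β i x.base c ∘ₗ x.hom⟩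

/-! ### The weighted blow-up of `S(F_i)` and its affine cone -/

/-- The complement of the zero section in `Hom(τ_i, π_i^* E_{> i})`. -/
abbrev HomGtNonzero (F : Fin (k + 1) → Type*) (E : Fin (k + 1) → M → Type*)
    [∀ j m, AddCommGroup (E j m)] [∀ j m, Module ℂ (E j m)] (i : Fin (k + 1)) : Type _ :=
  {y : HomTot F E i // y ∈ homGt F E i ∧ y.hom ≠ 0}

/-- The bundle over `ℙ(E_i)` of weighted projective spaces of `Hom(τ_i, π_i^* E_{> i})`, with the
weights `β_j - β_i`, `j > i`, and the quotient topology. -/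
abbrev WeightedProj (F : Fin (k + 1) → Type*) (E : Fin (k + 1) → M → Type*)
    [∀ j m, AddCommGroup (E j m)] [∀ j m, Module ℂ (E j m)] (β : Fin (k + 1) → ℕ)
    (i : Fin (k + 1)) : Type _ :=
  Quot fun y z : HomGtNonzero F E i => ∃ c : ℂˣ, z.1 = y.1.weightedAction β c

variable [∀ j, TopologicalSpace (TotalSpace (F j) (E j))]

/-- The weighted strict transform of `A ⊆ Hom(τ_i, π_i^* E_i')` in the weighted blow-up of the
subbundle `Hom(τ_i, π_i^* E_{< i})`: the closure of the graph of `(ℓ, A) ↦ [A_{> i}]` over the part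
of `A` outside of this subbundle. For `A = univ` this is the weighted blow-up. -/
def weightedStrictTransform (β : Fin (k + 1) → ℕ) (A : Set (HomTot F E i)) :
    Set (HomTot F E i × WeightedProj F E β i) :=
  closure {p | ∃ x ∈ A, ∃ h : x.gtPart ∈ homGt F E i ∧ x.gtPart.hom ≠ 0,
    p = (x, Quot.mk _ ⟨x.gtPart, h⟩)}

/-- The fibrewise affine cone over the weighted strict transform of a closed set `A`, a cone over
`A`: the weighted homogeneous equations of the strict transform are read as equations in
`Hom(τ_i, π_i^* E_i') ×_{ℙ(E_i)} Hom(τ_i, π_i^* E_{> i})`. Those of positive degree hold on the zero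
section and those of degree zero are the ones of `A`. -/
def affineCone (β : Fin (k + 1) → ℕ) (A : Set (HomTot F E i)) :
    Set (HomTot F E i × HomTot F E i) :=
  {p | p.1 ∈ A ∧ p.2 ∈ homGt F E i ∧ p.1.proj = p.2.proj ∧
    (p.2.hom = 0 ∨ ∃ h : p.2 ∈ homGt F E i ∧ p.2.hom ≠ 0,
      (p.1, Quot.mk _ ⟨p.2, h⟩) ∈ weightedStrictTransform β A)}

/-- The exceptional divisor of the affine cone of the weighted strict transform of
`A ⊆ ℙ(E) ∖ ℙ(E_i')`, as a subset of `ℙ(E) ×_M ℙ(E)`: the intersection of the cone with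
`Hom(τ_i, π_i^* E_{< i}) ×_{ℙ(E_i)} Hom(τ_i, π_i^* E_{> i})`, transferred by the chart. -/
def exceptionalDivisor (β : Fin (k + 1) → ℕ) (i : Fin (k + 1)) (A : Set (PE F E)) :
    Set (PE F E × PE F E) :=
  Prod.map HomTot.chart HomTot.chart ''
    (affineCone β (HomTot.chart ⁻¹' A) ∩ {p | p.1 ∈ homLt F E i})

end Components

end WeightedBlowup

end

/-!
A holomorphic section enters only through the fact that its image `S ⊆ ℙ(E)` is closed
(`isClosed_sectionImage`); the two equalities hold for every closed `S`.

All spaces involved are open quotients of spaces of nonzero vectors: `ℙ¹` of `ℂ² ∖ 0`, `ℙ(E)` of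
`E ∖ 0`, and `Hom(τ_i, π_i^* E_i')` of the vectors with `v_i ≠ 0`, the point `(ℓ, A)` being given by
any nonzero vector of the graph of `A` (`HomTot.ofVec`). Preimages under open maps commute with
closures, so that limits of lines lift to limits of vectors, which are computed in local
trivializations of the `E_j` (`tendsto_nonzeroVec_iff`).

At `[μ : λ]` with `μ, λ ≠ 0` the generators of the ideal map `[v]` to `[c * v]` with `c = λ / μ`. In
the chart the action of `c` has the weights `β_j - β_i`, and `c` tends to infinity as `[μ : λ]` tends
to `[0 : 1]`. Take a limit `([w], [v])` of pairs `([z], [c * z])`, with `w_{> i} = 0` and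
`v_{< i} = 0`, in the chart. As `c * z` and `z` have the same class in the weighted projective space
of `Hom(τ_i, π_i^* E_{> i})`, the pair `(w, [v_{> i}])` is a limit of points `(z, [z_{> i}])` if
`v_{> i} ≠ 0`, and thus lies in the weighted strict transform
(`mem_affineCone_of_mem_strictTransform`).

Conversely, suppose that `(w, [v])` is a limit of points `(z, [z_{> i}])` with `w_{> i} = 0` and
`v_{> i} ≠ 0`. The quotient by the weighted action is open, so there are `c` for which `c * z_{> i}`
tends to `v`. As `z_{> i}` tends to zero and `v` is nonzero, `c` tends to infinity, because the
weights above `i` are positive. As those below `i` are negative, the components of `c * z` below `i`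
tend to zero without further assumption, and `c * z` tends to `v`
(`mem_strictTransform_of_tendsto`). If `v_{> i} = 0`, a single orbit does: `c * w` tends to `[w_i]`
(`mem_strictTransform_of_mem_affineCone`).
-/

namespace WeightedBlowup

open Filter

/-! ### Lines and scalars -/

/-- The projection `ℂ² ∖ 0 → ℙ¹` is open, since its fibres are the orbits of a group of
homeomorphisms. -/
theorem isOpenMap_mk'_P1 :
    IsOpenMap (Projectivization.mk' ℂ : {q : Fin 2 → ℂ // q ≠ 0} → ℙ ℂ (Fin 2 → ℂ)) := by
  intro U hU
  rw [isOpen_coinduced]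
  have h : Projectivization.mk' ℂ ⁻¹' (Projectivization.mk' ℂ '' U) =
      ⋃ c : ℂˣ, {q : {q : Fin 2 → ℂ // q ≠ 0} |
        (⟨c • q.1, (smul_ne_zero_iff_ne c).2 q.2⟩ : {q : Fin 2 → ℂ // q ≠ 0}) ∈ U} := by
    ext q
    simp only [Set.mem_preimage, Set.mem_image, Set.mem_iUnion, Set.mem_ofPred_eq]
    constructor
    · rintro ⟨p, hp, hpq⟩
      obtain ⟨c, hc⟩ := (Projectivization.mk_eq_mk_iff ℂ _ _ p.2 q.2).1 hpq
      exact ⟨c, by simpa only [hc] using hp⟩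
    · rintro ⟨c, hc⟩
      exact ⟨_, hc, (Projectivization.mk_eq_mk_iff ℂ _ _ _ q.2).2 ⟨c, rfl⟩⟩
  rw [h]
  refine isOpen_iUnion fun c => hU.preimage ?_
  exact Continuous.subtype_mk (continuous_subtype_val.const_smul c) _

theorem continuous_mk'_P1 :
    Continuous (Projectivization.mk' ℂ : {q : Fin 2 → ℂ // q ≠ 0} → ℙ ℂ (Fin 2 → ℂ)) :=
  continuous_coinduced_rng

/-- If vectors converge to a nonzero limit and scalar multiples of them converge as well, then so do
the scalars. -/
theorem exists_tendsto_of_tendsto_smul {ι V : Type*} [NormedAddCommGroup V] [NormedSpace ℂ V]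
    {l : Filter ι} [l.NeBot] {b : ι → ℂ} {x : ι → V} {a y : V} (ha : a ≠ 0)
    (hx : Tendsto x l (𝓝 a)) (hy : Tendsto (fun n => b n • x n) l (𝓝 y)) :
    ∃ c, Tendsto b l (𝓝 c) ∧ c • a = y := by
  obtain ⟨φ, hφ⟩ := SeparatingDual.exists_eq_one (R := ℂ) ha
  have h₁ : Tendsto (fun n => φ (x n)) l (𝓝 1) := hφ ▸ (φ.continuous.tendsto a).comp hx
  have h₂ : Tendsto (fun n => φ (b n • x n)) l (𝓝 (φ y)) := (φ.continuous.tendsto y).comp hy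
  have h₃ : Tendsto b l (𝓝 (φ y / 1)) := by
    refine (h₂.div h₁ one_ne_zero).congr' ?_
    filter_upwards [h₁.eventually_ne one_ne_zero] with n hn
    simp [mul_div_assoc, div_self hn]
  exact ⟨_, h₃, tendsto_nhds_unique (h₃.smul hx) hy⟩

theorem tendsto_zero_of_tendsto_pow_zero {ι : Type*} {l : Filter ι} {ε : ι → ℂ} {N : ℕ}
    (h : Tendsto (fun n => ε n ^ N) l (𝓝 0)) : Tendsto ε l (𝓝 0) := by
  rw [Metric.tendsto_nhds] at h ⊢
  intro r hr
  filter_upwards [h (r ^ N) (pow_pos hr N)] with n hn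
  rw [dist_zero_right] at hn ⊢
  rw [norm_pow] at hn
  exact lt_of_pow_lt_pow_left₀ N hr.le hn

section Topology

variable {k : ℕ} {M : Type*} {F : Fin (k + 1) → Type*} {E : Fin (k + 1) → M → Type*}
  [∀ j m, AddCommGroup (E j m)] [∀ j m, Module ℂ (E j m)]

/-! ### The projection from nonzero vectors to lines -/

/-- Two nonzero vectors lie on the same line exactly when the second is a nonzero multiple of the
first; in particular they lie in the same fibre. -/
theorem NonzeroVec.toPE_eq_iff {z w : NonzeroVec F E} :
    z.toPE = w.toPE ↔ ∃ (c : ℂˣ), w = ⟨z.base, c • z.vec, (smul_ne_zero_iff_ne c).2 z.ne_zero⟩ := by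
  obtain ⟨m, v, hv⟩ := z
  obtain ⟨m', w, hw⟩ := w
  constructor
  · intro h
    obtain rfl : m = m' := congrArg PE.base h
    have h' : Projectivization.mk ℂ w hw = Projectivization.mk ℂ v hv := by
      simpa [NonzeroVec.toPE] using h.symm
    obtain ⟨c, hc⟩ := (Projectivization.mk_eq_mk_iff ℂ _ _ _ _).1 h'
    exact ⟨c, by simp [hc]⟩
  · rintro ⟨c, h⟩
    obtain rfl : m' = m := congrArg NonzeroVec.base h
    have h' : w = c • v := by simpa using h
    simp only [NonzeroVec.toPE, PE.mk.injEq, heq_eq_eq, true_and]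
    exact ((Projectivization.mk_eq_mk_iff ℂ _ _ _ _).2 ⟨c, h'.symm⟩).symm

variable (F E) in
theorem NonzeroVec.toPE_surjective :
    Function.Surjective (NonzeroVec.toPE : NonzeroVec F E → PE F E) := fun x =>
  ⟨⟨x.base, x.line.rep, x.line.rep_nonzero⟩, by simp [NonzeroVec.toPE]⟩

theorem toPE_mem_chartDomain {i : Fin (k + 1)} {z : NonzeroVec F E} :
    z.toPE ∈ chartDomain F E i ↔ z.vec i ≠ 0 := by
  constructor
  · rintro ⟨m, v, hv, h, hi⟩
    obtain ⟨c, hc⟩ := NonzeroVec.toPE_eq_iff.1 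
      (show (⟨m, v, hv⟩ : NonzeroVec F E).toPE = z.toPE from h.symm)
    rw [hc]
    exact (smul_ne_zero_iff_ne c).2 hi
  · exact fun h => ⟨z.base, z.vec, z.ne_zero, rfl, h⟩

variable [∀ j, TopologicalSpace (TotalSpace (F j) (E j))]

theorem NonzeroVec.continuous_toPE :
    Continuous (NonzeroVec.toPE : NonzeroVec F E → PE F E) := continuous_coinduced_rng

variable [∀ j m, TopologicalSpace (E j m)]

variable [TopologicalSpace M] [∀ j, NormedAddCommGroup (F j)] [∀ j, NormedSpace ℂ (F j)]
  [∀ j, FiberBundle (F j) (E j)] [∀ j, VectorBundle ℂ (F j) (E j)]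

variable (F E) in
/-- The coordinates of a vector of `E_j` in the preferred local trivialization around `m₀`, as a
linear map on each fibre (zero over points outside the domain of the trivialization). -/
noncomputable def coord (m₀ : M) (j : Fin (k + 1)) (m : M) : E j m →ₗ[ℂ] F j :=
  (trivializationAt (F j) (E j) m₀).linearMapAt ℂ m

theorem coord_self_eq_zero_iff {m₀ : M} {j : Fin (k + 1)} {v : E j m₀} :
    coord F E m₀ j m₀ v = 0 ↔ v = 0 := by
  refine ⟨fun h => ?_, fun h => by rw [h, map_zero]⟩
  have hm : m₀ ∈ (trivializationAt (F j) (E j) m₀).baseSet :=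
    FiberBundle.mem_baseSet_trivializationAt' m₀
  have h' := (trivializationAt (F j) (E j) m₀).symmₗ_linearMapAt (R := ℂ) hm v
  rw [← h']
  exact (congrArg _ h).trans (map_zero _)

theorem tendsto_totalSpace_iff {ι : Type*} {l : Filter ι} {j : Fin (k + 1)} {m₀ : M} {v₀ : E j m₀}
    {m : ι → M} {v : ∀ n, E j (m n)} :
    Tendsto (fun n => (⟨m n, v n⟩ : TotalSpace (F j) (E j))) l (𝓝 ⟨m₀, v₀⟩) ↔
      Tendsto m l (𝓝 m₀) ∧
        Tendsto (fun n => coord F E m₀ j (m n) (v n)) l (𝓝 (coord F E m₀ j m₀ v₀)) := by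
  have hm : m₀ ∈ (trivializationAt (F j) (E j) m₀).baseSet :=
    FiberBundle.mem_baseSet_trivializationAt' m₀
  have hz : (⟨m₀, v₀⟩ : TotalSpace (F j) (E j)) ∈ (trivializationAt (F j) (E j) m₀).source :=
    (trivializationAt (F j) (E j) m₀).mem_source.2 hm
  rw [(trivializationAt (F j) (E j) m₀).tendsto_nhds_iff hz]
  refine and_congr_right fun h => ?_
  have h' : ∀ᶠ n in l, m n ∈ (trivializationAt (F j) (E j) m₀).baseSet :=
    h.eventually ((trivializationAt (F j) (E j) m₀).open_baseSet.mem_nhds hm)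
  simp only [coord, Trivialization.coe_linearMapAt_of_mem _ hm]
  refine tendsto_congr' ?_
  filter_upwards [h'] with n hn
  simp [Trivialization.coe_linearMapAt_of_mem _ hn]

/-- Convergence in `E ∖ 0` is convergence of the base points and of the local coordinates. -/
theorem tendsto_nonzeroVec_iff {ι : Type*} {l : Filter ι} {f : ι → NonzeroVec F E}
    {z : NonzeroVec F E} :
    Tendsto f l (𝓝 z) ↔ Tendsto (fun n => (f n).base) l (𝓝 z.base) ∧
      ∀ j, Tendsto (fun n => coord F E z.base j (f n).base ((f n).vec j)) l
        (𝓝 (coord F E z.base j z.base (z.vec j))) := by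
  rw [nhds_induced, tendsto_comap_iff, tendsto_pi_nhds]
  simp only [Function.comp_def, tendsto_totalSpace_iff]
  exact ⟨fun h => ⟨(h 0).1, fun j => (h j).2⟩, fun h j => ⟨h.1, h.2 j⟩⟩

variable (F E) in
theorem NonzeroVec.continuous_base : Continuous (NonzeroVec.base : NonzeroVec F E → M) :=
  continuous_iff_continuousAt.2 fun z => (tendsto_nonzeroVec_iff.1 (tendsto_id (x := 𝓝 z))).1

theorem NonzeroVec.tendsto_coord (z : NonzeroVec F E) (j : Fin (k + 1)) :
    Tendsto (fun w : NonzeroVec F E => coord F E z.base j w.base (w.vec j)) (𝓝 z)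
      (𝓝 (coord F E z.base j z.base (z.vec j))) :=
  (tendsto_nonzeroVec_iff.1 (tendsto_id (x := 𝓝 z))).2 j

theorem NonzeroVec.eventually_apply_ne_zero {z : NonzeroVec F E} {j : Fin (k + 1)}
    (h : z.vec j ≠ 0) : ∀ᶠ w in 𝓝 z, w.vec j ≠ 0 := by
  filter_upwards [(z.tendsto_coord j).eventually_ne (mt coord_self_eq_zero_iff.1 h)] with w hw h0
  exact hw (by rw [h0, map_zero])

theorem isOpen_setOf_apply_ne_zero (j : Fin (k + 1)) :
    IsOpen {z : NonzeroVec F E | z.vec j ≠ 0} :=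
  isOpen_iff_mem_nhds.2 fun _ hz => NonzeroVec.eventually_apply_ne_zero hz

/-- The projection `E ∖ 0 → ℙ(E)` is open. -/
theorem NonzeroVec.isOpenMap_toPE : IsOpenMap (NonzeroVec.toPE : NonzeroVec F E → PE F E) := by
  intro U hU
  rw [isOpen_coinduced]
  have h : NonzeroVec.toPE ⁻¹' (NonzeroVec.toPE '' U) =
      ⋃ c : ℂˣ, {z : NonzeroVec F E |
        (⟨z.base, c • z.vec, (smul_ne_zero_iff_ne c).2 z.ne_zero⟩ : NonzeroVec F E) ∈ U} := by
    ext z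
    simp only [Set.mem_preimage, Set.mem_image, Set.mem_iUnion, Set.mem_ofPred_eq]
    constructor
    · rintro ⟨w, hw, hwz⟩
      obtain ⟨c, rfl⟩ := NonzeroVec.toPE_eq_iff.1 hwz.symm
      exact ⟨c, hw⟩
    · rintro ⟨c, hc⟩
      exact ⟨_, hc, (NonzeroVec.toPE_eq_iff.2 ⟨c, rfl⟩).symm⟩
  rw [h]
  refine isOpen_iUnion fun c => hU.preimage ?_
  refine continuous_iff_continuousAt.2 fun z => tendsto_nonzeroVec_iff.2
    ⟨(NonzeroVec.continuous_base F E).tendsto z, fun j => ?_⟩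
  have := (z.tendsto_coord j).const_smul (c : ℂ)
  simpa [Units.smul_def] using this

theorem isOpen_chartDomain (i : Fin (k + 1)) : IsOpen (chartDomain F E i) := by
  rw [isOpen_coinduced]
  convert isOpen_setOf_apply_ne_zero (F := F) (E := E) i using 1
  ext z
  exact toPE_mem_chartDomain

/-- The image of a holomorphic section of `ℙ(E)` is closed. -/
theorem isClosed_sectionImage {EM : Type*} [NormedAddCommGroup EM] [NormedSpace ℂ EM]
    [ChartedSpace EM M] {s : ∀ m, ℙ ℂ (Fib E m)}
    (hs : IsHolomorphicSection (EM := EM) F E s) : IsClosed (sectionImage F E s) := by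
  refine isClosed_of_closure_subset fun x hx => ?_
  obtain ⟨z, rfl⟩ := NonzeroVec.toPE_surjective F E x
  have hz := NonzeroVec.isOpenMap_toPE.preimage_closure_subset_closure_preimage hx
  obtain ⟨u, hu, huz⟩ := mem_closure_iff_ultrafilter.1 hz
  obtain ⟨hb, hc⟩ := tendsto_nonzeroVec_iff.1 (tendsto_id'.2 huz)
  obtain ⟨U, hU, σ, hσ, hσs⟩ := hs z.base
  obtain ⟨hσ0, hsσ⟩ := hσs _ (mem_of_mem_nhds hU)
  obtain ⟨j₀, hj₀⟩ : ∃ j, σ z.base j ≠ 0 := Function.ne_iff.1 hσ0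
  -- Near `z`, the points over the image of `s` are multiples of the values of `σ`.
  have hmul : ∀ w ∈ NonzeroVec.toPE ⁻¹' sectionImage F E s, w.base ∈ U →
      ∃ b : ℂ, w.vec = b • σ w.base := by
    rintro w ⟨m, hm⟩ hwU
    obtain ⟨m', v, hv⟩ := w
    obtain rfl : m = m' := congrArg PE.base hm
    obtain ⟨h0, h1⟩ := hσs m hwU
    have h2 : s m = Projectivization.mk ℂ v hv := by simpa [NonzeroVec.toPE] using hm
    obtain ⟨c, h⟩ := (Projectivization.mk_eq_mk_iff ℂ _ _ _ _).1 (h2.symm.trans h1)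
    exact ⟨c, h.symm⟩
  have hev : ∀ᶠ w in (u : Filter (NonzeroVec F E)), ∃ b : ℂ, w.vec = b • σ w.base := by
    filter_upwards [hu, hb.eventually hU] with w hw hwU using hmul w hw hwU
  choose! b hb' using fun (w : NonzeroVec F E) (h : ∃ b : ℂ, w.vec = b • σ w.base) => h
  have hσc : ∀ j, Tendsto (fun w : NonzeroVec F E => coord F E z.base j w.base (σ w.base j)) u
      (𝓝 (coord F E z.base j z.base (σ z.base j))) := fun j =>
    (tendsto_totalSpace_iff.1
      (((hσ j).continuousOn.continuousAt hU).tendsto.comp hb)).2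
  have hbc : ∀ j, Tendsto (fun w : NonzeroVec F E => b w • coord F E z.base j w.base (σ w.base j))
      u (𝓝 (coord F E z.base j z.base (z.vec j))) := fun j => by
    refine (hc j).congr' ?_
    filter_upwards [hev] with w hw
    conv_lhs => rw [id, hb' w hw]
    simp
  obtain ⟨c, hbc', -⟩ := exists_tendsto_of_tendsto_smul (mt coord_self_eq_zero_iff.1 hj₀)
    (hσc j₀) (hbc j₀)
  have hzσ : z.vec = c • σ z.base := by
    funext j
    have h := tendsto_nhds_unique (hbc j) (hbc'.smul (hσc j))
    rw [← map_smul, ← sub_eq_zero, ← map_sub, coord_self_eq_zero_iff, sub_eq_zero] at h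
    exact h
  refine ⟨z.base, ?_⟩
  change (⟨z.base, s z.base⟩ : PE F E) = ⟨z.base, Projectivization.mk ℂ z.vec z.ne_zero⟩
  rw [hsσ]
  congr 1
  exact ((Projectivization.mk_eq_mk_iff' ℂ _ _ _ _).2 ⟨c, hzσ.symm⟩).symm

end Topology

section Chart

variable {k : ℕ} {M : Type*} {F : Fin (k + 1) → Type*} {E : Fin (k + 1) → M → Type*}
  [∀ j m, AddCommGroup (E j m)] [∀ j m, Module ℂ (E j m)] {i : Fin (k + 1)}

/-! ### The chart in terms of vectors -/

/-- The component in `E_i'` of a vector of `E = E_i ⊕ E_i'`. -/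
def offPart (i : Fin (k + 1)) {m : M} (v : Fib E m) : offFib E i m :=
  ⟨Function.update v i 0, by simp [offFib]⟩

theorem offPart_apply {m : M} (v : Fib E m) (j : Fin (k + 1)) :
    (offPart i v : Fib E m) j = if j = i then 0 else v j := by
  by_cases h : j = i
  · subst h; simp [offPart]
  · simp [offPart, h]

/-- The point of `Hom(τ_i, π_i^* E_i')` whose graph is the line through a vector with nonzero `i`-th
component: the map sends `u = c v_i` to the component of `c v` in `E_i'`. -/
noncomputable abbrev HomTot.ofVec (z : NonzeroVec F E) (h : z.vec i ≠ 0) : HomTot F E i :=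
  ⟨z.base, Projectivization.mk ℂ (z.vec i) h,
    ((LinearEquiv.coord ℂ (E i z.base) (z.vec i) h).toLinearMap ∘ₗ
      (LinearEquiv.ofEq _ _ (Projectivization.submodule_mk (z.vec i) h)).toLinearMap).smulRight
        (offPart i z.vec)⟩

theorem HomTot.ofVec_hom_self {z : NonzeroVec F E} {h : z.vec i ≠ 0}
    (hu : z.vec i ∈ (HomTot.ofVec z h).line.submodule) :
    (HomTot.ofVec z h).hom ⟨z.vec i, hu⟩ = offPart i z.vec := by
  have : LinearEquiv.coord ℂ (E i z.base) (z.vec i) h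
      (LinearEquiv.ofEq _ _ (Projectivization.submodule_mk (z.vec i) h) ⟨z.vec i, hu⟩) = 1 :=
    LinearEquiv.coord_self ℂ _ _ h
  exact (congrArg (· • offPart i z.vec) this).trans (one_smul _ _)

/-- A line is the span of each of its nonzero vectors. -/
theorem exists_smul_eq_of_mem_line {V : Type*} [AddCommGroup V] [Module ℂ V] {ℓ : ℙ ℂ V}
    {u : ℓ.submodule} (hu : u ≠ 0) (u' : ℓ.submodule) : ∃ c : ℂ, u' = c • u := by
  obtain ⟨c, hc⟩ := (finrank_eq_one_iff_of_nonzero' u hu).1 ℓ.finrank_submodule u'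
  exact ⟨c, hc.symm⟩

/-- The chart is the line through the graph vector of any nonzero `u ∈ ℓ`. -/
theorem HomTot.chart_eq_toPE (x : HomTot F E i) {u : x.line.submodule} (hu : u ≠ 0) :
    x.chart = (⟨x.base, x.graphVec u, x.graphVec_ne_zero hu⟩ : NonzeroVec F E).toPE := by
  obtain ⟨c, hc⟩ := exists_smul_eq_of_mem_line hu x.gen
  have h : Projectivization.mk ℂ (x.graphVec x.gen) (x.graphVec_ne_zero x.gen_ne_zero) =
      Projectivization.mk ℂ (x.graphVec u) (x.graphVec_ne_zero hu) :=
    (Projectivization.mk_eq_mk_iff' ℂ _ _ _ _).2 ⟨c, by rw [hc, map_smul]⟩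
  simp [HomTot.chart, NonzeroVec.toPE, h]

theorem HomTot.graphVec_apply_of_ne (x : HomTot F E i) (u : x.line.submodule) {j : Fin (k + 1)}
    (hj : j ≠ i) : x.graphVec u j = (x.hom u : Fib E x.base) j := by
  simp [HomTot.graphVec, Pi.single_eq_of_ne hj]

theorem HomTot.chart_injective : Function.Injective (HomTot.chart : HomTot F E i → PE F E) := by
  intro x y h
  obtain ⟨m, ℓ, A⟩ := x
  obtain ⟨m', ℓ', B⟩ := y
  obtain rfl : m = m' := congrArg PE.base h
  have hr : LinearMap.range (⟨m, ℓ, A⟩ : HomTot F E i).graphVec =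
      LinearMap.range (⟨m, ℓ', B⟩ : HomTot F E i).graphVec := by
    rw [← HomTot.chart_submodule, ← HomTot.chart_submodule]
    congr 1
    simpa [HomTot.chart] using h
  -- The graph determines the line as its image in `E_i`, and then the map.
  have key : ∀ u : ℓ.submodule, ∃ u' : ℓ'.submodule, (u' : E i m) = u ∧ B u' = A u := by
    intro u
    obtain ⟨u', hu'⟩ : (⟨m, ℓ, A⟩ : HomTot F E i).graphVec u ∈
        LinearMap.range (⟨m, ℓ', B⟩ : HomTot F E i).graphVec := hr ▸ ⟨u, rfl⟩
    refine ⟨u', ?_, ?_⟩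
    · exact ((HomTot.graphVec_apply_self (⟨m, ℓ', B⟩ : HomTot F E i) u').symm.trans
        (congrFun hu' i)).trans (HomTot.graphVec_apply_self (⟨m, ℓ, A⟩ : HomTot F E i) u)
    · ext j
      by_cases hj : j = i
      · subst hj
        exact (B u').2.trans (A u).2.symm
      · have := congrFun hu' j
        rwa [HomTot.graphVec_apply_of_ne _ _ hj, HomTot.graphVec_apply_of_ne _ _ hj] at this
  have hle : ℓ.submodule ≤ ℓ'.submodule := fun u hu => by
    obtain ⟨u', hu', -⟩ := key ⟨u, hu⟩
    have h : (u' : E i m) = u := hu'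
    exact h ▸ u'.2
  obtain rfl : ℓ = ℓ' := Projectivization.submodule_injective <|
    haveI : FiniteDimensional ℂ ℓ'.submodule :=
      FiniteDimensional.of_finrank_eq_succ ℓ'.finrank_submodule
    Submodule.eq_of_le_of_finrank_eq hle (ℓ.finrank_submodule.trans ℓ'.finrank_submodule.symm)
  have : A = B := LinearMap.ext fun u => by
    obtain ⟨u', h₁, h₂⟩ := key u
    rw [← h₂, Subtype.ext h₁]
  rw [this]

@[simp]
theorem HomTot.chart_ofVec (z : NonzeroVec F E) (h : z.vec i ≠ 0) :
    (HomTot.ofVec z h).chart = z.toPE := by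
  have hu : z.vec i ∈ (HomTot.ofVec z h).line.submodule := by
    simp only [HomTot.ofVec, Projectivization.submodule_mk]
    exact Submodule.mem_span_singleton_self _
  have hu0 : (⟨z.vec i, hu⟩ : (HomTot.ofVec z h).line.submodule) ≠ 0 :=
    fun h0 => h (congrArg Subtype.val h0)
  rw [HomTot.chart_eq_toPE _ hu0]
  have : (HomTot.ofVec z h).graphVec ⟨z.vec i, hu⟩ = z.vec := by
    funext j
    by_cases hj : j = i
    · subst hj; exact HomTot.graphVec_apply_self _ _
    · rw [HomTot.graphVec_apply_of_ne _ _ hj, HomTot.ofVec_hom_self, offPart_apply, if_neg hj]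
  congr 1
  obtain ⟨m, v, hv⟩ := z
  simpa [HomTot.ofVec] using this

/-- Every point of `Hom(τ_i, π_i^* E_i')` comes from a vector, and any nonzero vector of `ℓ` can be
prescribed as its `i`-th component. -/
theorem HomTot.exists_eq_ofVec (x : HomTot F E i) {e : E i x.base} (he : e ≠ 0)
    (hx : x.line = Projectivization.mk ℂ e he) :
    ∃ (v : Fib E x.base) (hv : v ≠ 0) (hi : v i ≠ 0), v i = e ∧
      x = HomTot.ofVec ⟨x.base, v, hv⟩ hi := by
  have hu : e ∈ x.line.submodule := by
    rw [hx, Projectivization.submodule_mk]; exact Submodule.mem_span_singleton_self _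
  have hu0 : (⟨e, hu⟩ : x.line.submodule) ≠ 0 := fun h0 => he (congrArg Subtype.val h0)
  have hi := x.graphVec_apply_self ⟨e, hu⟩
  refine ⟨x.graphVec ⟨e, hu⟩, x.graphVec_ne_zero hu0, by rw [hi]; exact he, hi, ?_⟩
  apply HomTot.chart_injective
  rw [HomTot.chart_ofVec, ← HomTot.chart_eq_toPE _ hu0]

/-- Points over the same line come from vectors with the same `i`-th component. -/
theorem HomTot.exists_eq_ofVec_of_proj_eq {x y : HomTot F E i} (h : x.proj = y.proj) :
    ∃ (m : M) (a b : Fib E m) (ha : a ≠ 0) (hb : b ≠ 0) (hai : a i ≠ 0) (hbi : b i ≠ 0),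
      a i = b i ∧ x = HomTot.ofVec ⟨m, a, ha⟩ hai ∧ y = HomTot.ofVec ⟨m, b, hb⟩ hbi := by
  obtain ⟨m, ℓ, A⟩ := x
  obtain ⟨m', ℓ', B⟩ := y
  obtain ⟨rfl, hℓ⟩ := Sigma.mk.inj h
  obtain rfl := eq_of_heq hℓ
  obtain ⟨a, ha, hai, hae, hxa⟩ := HomTot.exists_eq_ofVec ⟨m, ℓ, A⟩ ℓ.rep_nonzero ℓ.mk_rep.symm
  obtain ⟨b, hb, hbi, hbe, hyb⟩ := HomTot.exists_eq_ofVec ⟨m, ℓ, B⟩ ℓ.rep_nonzero ℓ.mk_rep.symm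
  exact ⟨m, a, b, ha, hb, hai, hbi, hae.trans hbe.symm, hxa, hyb⟩

theorem HomTot.exists_eq_ofVec' (x : HomTot F E i) :
    ∃ (z : NonzeroVec F E) (h : z.vec i ≠ 0), x = HomTot.ofVec z h := by
  obtain ⟨v, hv, hi, -, h⟩ := x.exists_eq_ofVec x.line.rep_nonzero x.line.mk_rep.symm
  exact ⟨_, hi, h⟩

/-- Vanishing of a component of the map `ofVec z` can be tested on `z`. -/
theorem HomTot.ofVec_hom_apply_eq_zero_iff {z : NonzeroVec F E} {h : z.vec i ≠ 0}
    {j : Fin (k + 1)} (hj : j ≠ i) :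
    (∀ u, ((HomTot.ofVec z h).hom u : Fib E z.base) j = 0) ↔ z.vec j = 0 := by
  have hu : z.vec i ∈ (HomTot.ofVec z h).line.submodule := by
    simp only [HomTot.ofVec, Projectivization.submodule_mk]
    exact Submodule.mem_span_singleton_self _
  have hu0 : (⟨z.vec i, hu⟩ : (HomTot.ofVec z h).line.submodule) ≠ 0 :=
    fun h0 => h (congrArg Subtype.val h0)
  have key := congrArg (fun a : offFib E i z.base => (a : Fib E z.base) j)
    (HomTot.ofVec_hom_self (h := h) hu)
  simp only [offPart_apply, if_neg hj] at key
  constructor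
  · exact fun H => key.symm.trans (H _)
  · intro H u
    obtain ⟨c, rfl⟩ := exists_smul_eq_of_mem_line hu0 u
    rw [map_smul]
    change c • _ = (0 : E j z.base)
    rw [H] at key
    exact (congrArg (c • ·) key).trans (smul_zero c)

theorem HomTot.ofVec_mem_homLt {z : NonzeroVec F E} {h : z.vec i ≠ 0} :
    HomTot.ofVec z h ∈ homLt F E i ↔ ∀ j, i < j → z.vec j = 0 :=
  ⟨fun H _ hj => (HomTot.ofVec_hom_apply_eq_zero_iff hj.ne').1 fun u => H u _ hj,
    fun H u j hj => (HomTot.ofVec_hom_apply_eq_zero_iff hj.ne').2 (H j hj) u⟩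

theorem HomTot.ofVec_mem_homGt {z : NonzeroVec F E} {h : z.vec i ≠ 0} :
    HomTot.ofVec z h ∈ homGt F E i ↔ ∀ j, j < i → z.vec j = 0 :=
  ⟨fun H _ hj => (HomTot.ofVec_hom_apply_eq_zero_iff hj.ne).1 fun u => H u _ hj,
    fun H u j hj => (HomTot.ofVec_hom_apply_eq_zero_iff hj.ne).2 (H j hj) u⟩

theorem HomTot.ofVec_hom_eq_zero_iff {z : NonzeroVec F E} {h : z.vec i ≠ 0} :
    (HomTot.ofVec z h).hom = 0 ↔ ∀ j, j ≠ i → z.vec j = 0 := by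
  constructor
  · intro H j hj
    refine (HomTot.ofVec_hom_apply_eq_zero_iff (h := h) hj).1 fun u => ?_
    rw [H]; rfl
  · intro H
    ext u j
    by_cases hj : j = i
    · subst hj
      exact ((HomTot.ofVec z h).hom u).2
    · exact (HomTot.ofVec_hom_apply_eq_zero_iff (h := h) hj).2 (H j hj) u

/-! ### Diagonal maps, the projection to `E_{> i}`, and the weighted action -/

/-- The map of `E` that multiplies the component in `E_j` by `a j`, on vectors whose `i`-th component
is nonzero. -/
abbrev NonzeroVec.diag (a : Fin (k + 1) → ℂ) (z : NonzeroVec F E) (hz : z.vec i ≠ 0) (ha : a i ≠ 0) :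
    NonzeroVec F E :=
  ⟨z.base, fun j => a j • z.vec j, fun h => smul_ne_zero ha hz (congrFun h i)⟩

/-- A fibrewise map of `Hom(τ_i, π_i^* E_i')` that multiplies the components by scalars corresponds
to a diagonal map of `E` under the chart. -/
theorem HomTot.chart_eq_toPE_diag {a : Fin (k + 1) → ℂ} (ha : a i = 1) {z : NonzeroVec F E}
    (hz : z.vec i ≠ 0) {B : (HomTot.ofVec z hz).line.submodule →ₗ[ℂ] offFib E i z.base}
    (hB : ∀ u j, (B u : Fib E z.base) j = a j • ((HomTot.ofVec z hz).hom u : Fib E z.base) j) :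
    HomTot.chart (⟨z.base, (HomTot.ofVec z hz).line, B⟩ : HomTot F E i) =
      (NonzeroVec.diag a z hz (ha ▸ one_ne_zero)).toPE := by
  have hu : z.vec i ∈ (HomTot.ofVec z hz).line.submodule := by
    simp only [HomTot.ofVec, Projectivization.submodule_mk]
    exact Submodule.mem_span_singleton_self _
  have hu0 : (⟨z.vec i, hu⟩ : (HomTot.ofVec z hz).line.submodule) ≠ 0 :=
    fun h0 => hz (congrArg Subtype.val h0)
  refine (HomTot.chart_eq_toPE (⟨z.base, (HomTot.ofVec z hz).line, B⟩ : HomTot F E i) hu0).trans ?_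
  congr 2
  funext j
  by_cases hj : j = i
  · subst hj
    rw [HomTot.graphVec_apply_self, ha, one_smul]
  · rw [HomTot.graphVec_apply_of_ne _ _ hj, hB]
    have := HomTot.ofVec_hom_self (h := hz) hu
    rw [this, offPart_apply, if_neg hj]

/-- The multipliers of the projection to `E_{≥ i}`. -/
def geScalar (i j : Fin (k + 1)) : ℂ := if i ≤ j then 1 else 0

theorem geScalar_self (i : Fin (k + 1)) : geScalar i i = 1 := if_pos le_rfl

/-- The multipliers of the weighted action of `c`. -/
noncomputable def weightScalar (β : Fin (k + 1) → ℕ) (i : Fin (k + 1)) (c : ℂˣ)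
    (j : Fin (k + 1)) : ℂ :=
  (c : ℂ) ^ ((β j : ℤ) - (β i : ℤ))

theorem weightScalar_self (β : Fin (k + 1) → ℕ) (i : Fin (k + 1)) (c : ℂˣ) :
    weightScalar β i c i = 1 := by simp [weightScalar]

theorem HomTot.gtPart_ofVec (z : NonzeroVec F E) (h : z.vec i ≠ 0) :
    (HomTot.ofVec z h).gtPart =
      HomTot.ofVec (NonzeroVec.diag (geScalar i) z h (geScalar_self i ▸ one_ne_zero))
        (smul_ne_zero (geScalar_self i ▸ one_ne_zero) h) := by
  apply HomTot.chart_injective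
  rw [HomTot.chart_ofVec]
  refine HomTot.chart_eq_toPE_diag (geScalar_self i) h fun u j => ?_
  have h0 : ((HomTot.ofVec z h).hom u : Fib E z.base) i = 0 := ((HomTot.ofVec z h).hom u).2
  simp only [LinearMap.comp_apply, gtMap, geScalar, LinearMap.coe_mk, AddHom.coe_mk]
  rcases lt_trichotomy i j with hj | rfl | hj
  · rw [if_pos hj, if_pos hj.le, one_smul]
  · rw [if_neg (lt_irrefl i), h0, smul_zero]
  · rw [if_neg hj.not_gt, if_neg hj.not_ge, zero_smul]

theorem HomTot.weightedAction_ofVec (β : Fin (k + 1) → ℕ) (c : ℂˣ) (z : NonzeroVec F E)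
    (h : z.vec i ≠ 0) :
    (HomTot.ofVec z h).weightedAction β c =
      HomTot.ofVec (NonzeroVec.diag (weightScalar β i c) z h
        (weightScalar_self β i c ▸ one_ne_zero))
        (smul_ne_zero (weightScalar_self β i c ▸ one_ne_zero) h) := by
  apply HomTot.chart_injective
  rw [HomTot.chart_ofVec]
  exact HomTot.chart_eq_toPE_diag (weightScalar_self β i c) h fun u j => rfl

/-- The multipliers of the weighted action of `c` on the projection to `E_{≥ i}`. -/
def orbitScalar (β : Fin (k + 1) → ℕ) (i : Fin (k + 1)) (c : ℂ) (j : Fin (k + 1)) : ℂ :=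
  if i ≤ j then c ^ (β j - β i) else 0

theorem orbitScalar_self (β : Fin (k + 1) → ℕ) (i : Fin (k + 1)) (c : ℂ) :
    orbitScalar β i c i = 1 := by simp [orbitScalar]

theorem HomTot.weightedAction_gtPart_ofVec {β : Fin (k + 1) → ℕ} (hβ : Monotone β) (c : ℂˣ)
    (z : NonzeroVec F E) (h : z.vec i ≠ 0) :
    (HomTot.ofVec z h).gtPart.weightedAction β c =
      HomTot.ofVec (NonzeroVec.diag (orbitScalar β i c) z h
        (orbitScalar_self β i c ▸ one_ne_zero))
        (smul_ne_zero (orbitScalar_self β i c ▸ one_ne_zero) h) := by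
  apply HomTot.chart_injective
  rw [HomTot.chart_ofVec]
  refine HomTot.chart_eq_toPE_diag (orbitScalar_self β i c) h fun u j => ?_
  have h0 : ((HomTot.ofVec z h).hom u : Fib E z.base) i = 0 := ((HomTot.ofVec z h).hom u).2
  change weightScalar β i c j • (if i < j then ((HomTot.ofVec z h).hom u : Fib E z.base) j else 0) =
    _
  rcases lt_trichotomy i j with hj | rfl | hj
  · rw [if_pos hj, orbitScalar, if_pos hj.le, weightScalar, ← Nat.cast_sub (hβ hj.le),
      zpow_natCast]
  · rw [if_neg (lt_irrefl i), h0, smul_zero, smul_zero]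
  · rw [if_neg hj.not_gt, orbitScalar, if_neg hj.not_ge, zero_smul, smul_zero]

theorem HomTot.gtPart_mem_homGt (x : HomTot F E i) : x.gtPart ∈ homGt F E i :=
  fun _ _ hj => if_neg hj.not_gt

theorem HomTot.weightedAction_one (β : Fin (k + 1) → ℕ) (x : HomTot F E i) :
    x.weightedAction β 1 = x := by
  obtain ⟨m, ℓ, A⟩ := x
  have : weightMap E β i m 1 ∘ₗ A = A := by
    ext u j
    simp [weightMap]
  exact congrArg (HomTot.mk m ℓ) this

theorem HomTot.weightedAction_weightedAction (β : Fin (k + 1) → ℕ) (c d : ℂˣ) (x : HomTot F E i) :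
    (x.weightedAction β c).weightedAction β d = x.weightedAction β (d * c) := by
  obtain ⟨m, ℓ, A⟩ := x
  have : weightMap E β i m d ∘ₗ weightMap E β i m c ∘ₗ A = weightMap E β i m (d * c) ∘ₗ A := by
    ext u j
    simp [weightMap, smul_smul, mul_zpow]
  exact congrArg (HomTot.mk m ℓ) this

theorem HomTot.weightedAction_mem {β : Fin (k + 1) → ℕ} {c : ℂˣ} {y : HomTot F E i}
    (hy : y ∈ homGt F E i ∧ y.hom ≠ 0) :
    y.weightedAction β c ∈ homGt F E i ∧ (y.weightedAction β c).hom ≠ 0 := by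
  refine ⟨fun u j hj => ?_, fun h => hy.2 ?_⟩
  · have : weightScalar β i c j • (y.hom u : Fib E y.base) j = 0 := by rw [hy.1 u j hj, smul_zero]
    exact this
  · ext u j
    have h₁ := congrArg (fun a : offFib E i y.base => (a : Fib E y.base) j)
      (LinearMap.congr_fun h u)
    have h₂ : weightScalar β i c j • (y.hom u : Fib E y.base) j = 0 := h₁
    exact (smul_eq_zero.1 h₂).resolve_left (zpow_ne_zero _ c.ne_zero)

/-- Points of the weighted projective bundle agree only if the vectors are in the same orbit of the
weighted action. -/
theorem exists_weightedAction_eq_of_quot_eq {β : Fin (k + 1) → ℕ} {y z : HomGtNonzero F E i}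
    (h : (Quot.mk _ y : WeightedProj F E β i) = Quot.mk _ z) :
    ∃ c : ℂˣ, z.1 = y.1.weightedAction β c := by
  have he : Equivalence fun y z : HomGtNonzero F E i => ∃ c : ℂˣ, z.1 = y.1.weightedAction β c :=
    ⟨fun y => ⟨1, (y.1.weightedAction_one β).symm⟩,
      fun {y z} ⟨c, hc⟩ => ⟨c⁻¹, by
        rw [hc, HomTot.weightedAction_weightedAction, inv_mul_cancel, HomTot.weightedAction_one]⟩,
      fun {x y z} ⟨c, hc⟩ ⟨d, hd⟩ => ⟨d * c, by
        rw [hd, hc, HomTot.weightedAction_weightedAction]⟩⟩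
  exact he.eqvGen_iff.1 (Quot.eqvGen_exact h)

end Chart

section HomTopology

variable {k : ℕ} {M : Type*} {F : Fin (k + 1) → Type*} {E : Fin (k + 1) → M → Type*}
  [∀ j m, AddCommGroup (E j m)] [∀ j m, Module ℂ (E j m)]
  [∀ j, TopologicalSpace (TotalSpace (F j) (E j))] [∀ j m, TopologicalSpace (E j m)]
  [TopologicalSpace M] [∀ j, NormedAddCommGroup (F j)] [∀ j, NormedSpace ℂ (F j)]
  [∀ j, FiberBundle (F j) (E j)] [∀ j, VectorBundle ℂ (F j) (E j)]
  {i : Fin (k + 1)}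

/-! ### The topology of the chart -/

/-- The bundle `Hom(τ_i, π_i^* E_i')` is an open quotient of the vectors with nonzero `i`-th
component. -/
theorem HomTot.isOpenQuotientMap_ofVec :
    IsOpenQuotientMap
      (fun z : {z : NonzeroVec F E // z.vec i ≠ 0} => HomTot.ofVec z.1 z.2) := by
  have hchart : (HomTot.chart : HomTot F E i → PE F E) ∘
      (fun z : {z : NonzeroVec F E // z.vec i ≠ 0} => HomTot.ofVec z.1 z.2) =
      fun z => z.1.toPE := funext fun z => HomTot.chart_ofVec z.1 z.2
  refine ⟨fun x => ?_, continuous_induced_rng.2 ?_, fun U hU => ?_⟩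
  · obtain ⟨z, h, rfl⟩ := x.exists_eq_ofVec'
    exact ⟨⟨z, h⟩, rfl⟩
  · rw [hchart]
    exact NonzeroVec.continuous_toPE.comp continuous_subtype_val
  · refine isOpen_induced_iff.2 ⟨(fun z => z.1.toPE) '' U, ?_, ?_⟩
    · exact (NonzeroVec.isOpenMap_toPE.comp
        (isOpen_setOf_apply_ne_zero (F := F) (E := E) i).isOpenMap_subtype_val) U hU
    · rw [← hchart, Set.image_comp, Set.preimage_image_eq _ HomTot.chart_injective]

theorem NonzeroVec.continuous_diag {a : Fin (k + 1) → ℂ} (ha : a i ≠ 0) :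
    Continuous fun z : {z : NonzeroVec F E // z.vec i ≠ 0} => NonzeroVec.diag a z.1 z.2 ha := by
  refine continuous_iff_continuousAt.2 fun z => tendsto_nonzeroVec_iff.2 ⟨?_, fun j => ?_⟩
  · exact ((NonzeroVec.continuous_base F E).comp continuous_subtype_val).tendsto z
  · have h : Tendsto (Subtype.val : {z : NonzeroVec F E // z.vec i ≠ 0} → _) (𝓝 z) (𝓝 z.1) :=
      continuous_subtype_val.tendsto z
    simpa using ((z.1.tendsto_coord j).comp h).const_smul (a j)

theorem HomTot.continuous_gtPart :
    Continuous (HomTot.gtPart : HomTot F E i → HomTot F E i) := by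
  rw [HomTot.isOpenQuotientMap_ofVec.isQuotientMap.continuous_iff, continuous_induced_rng]
  refine (NonzeroVec.continuous_toPE.comp (NonzeroVec.continuous_diag (F := F) (E := E) (i := i)
    (a := geScalar i) (geScalar_self i ▸ one_ne_zero))).congr fun z => ?_
  simp only [Function.comp_apply]
  rw [HomTot.gtPart_ofVec, HomTot.chart_ofVec]

theorem HomTot.continuous_weightedAction (β : Fin (k + 1) → ℕ) (c : ℂˣ) :
    Continuous (HomTot.weightedAction β c : HomTot F E i → HomTot F E i) := by
  rw [HomTot.isOpenQuotientMap_ofVec.isQuotientMap.continuous_iff, continuous_induced_rng]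
  refine (NonzeroVec.continuous_toPE.comp (NonzeroVec.continuous_diag (F := F) (E := E) (i := i)
    (a := weightScalar β i c) (weightScalar_self β i c ▸ one_ne_zero))).congr fun z => ?_
  simp only [Function.comp_apply]
  rw [HomTot.weightedAction_ofVec, HomTot.chart_ofVec]

/-- The quotient map onto the bundle of weighted projective spaces is open. -/
theorem isOpenMap_quot_mk_weightedProj (β : Fin (k + 1) → ℕ) :
    IsOpenMap (Quot.mk _ : HomGtNonzero F E i → WeightedProj F E β i) := by
  intro U hU
  rw [isOpen_coinduced]
  have h : Quot.mk _ ⁻¹' ((Quot.mk _ : HomGtNonzero F E i → WeightedProj F E β i) '' U) =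
      ⋃ c : ℂˣ, (fun y : HomGtNonzero F E i =>
        (⟨y.1.weightedAction β c, HomTot.weightedAction_mem y.2⟩ : HomGtNonzero F E i)) ⁻¹' U := by
    ext y
    simp only [Set.mem_preimage, Set.mem_image, Set.mem_iUnion]
    constructor
    · rintro ⟨z, hz, h⟩
      obtain ⟨c, hc⟩ := exists_weightedAction_eq_of_quot_eq h.symm
      exact ⟨c, by simpa only [← hc] using hz⟩
    · rintro ⟨c, hc⟩
      exact ⟨_, hc, (Quot.sound ⟨c, rfl⟩).symm⟩
  rw [h]
  exact isOpen_iUnion fun c => hU.preimage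
    (((HomTot.continuous_weightedAction β c).comp continuous_subtype_val).subtype_mk _)

/-- Points of the affine cone off the zero section are limits of pairs `(x, c · x_{> i})`. -/
theorem mem_closure_of_mem_weightedStrictTransform {β : Fin (k + 1) → ℕ} {A : Set (HomTot F E i)}
    {x : HomTot F E i} {y : HomGtNonzero F E i}
    (h : (x, (Quot.mk _ y : WeightedProj F E β i)) ∈ weightedStrictTransform β A) :
    (x, y.1) ∈ closure {p : HomTot F E i × HomTot F E i |
      p.1 ∈ A ∧ ∃ c : ℂˣ, p.2 = p.1.gtPart.weightedAction β c} := by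
  have ho := (IsOpenMap.id (X := HomTot F E i)).prodMap
    (isOpenMap_quot_mk_weightedProj (F := F) (E := E) (i := i) β)
  have h' : (x, y) ∈ closure (Prod.map id
      (Quot.mk _ : HomGtNonzero F E i → WeightedProj F E β i) ⁻¹' _) :=
    ho.preimage_closure_subset_closure_preimage h
  refine map_mem_closure (f := Prod.map id Subtype.val)
    (continuous_id.prodMap continuous_subtype_val) h' ?_
  rintro ⟨x', y'⟩ ⟨x'', hx'', hgt, heq⟩
  obtain ⟨rfl, h₂⟩ := Prod.mk.inj heq
  exact ⟨hx'', exists_weightedAction_eq_of_quot_eq h₂.symm⟩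

end HomTopology

section Graph

variable {k : ℕ} {M : Type*} {F : Fin (k + 1) → Type*} {E : Fin (k + 1) → M → Type*}
  [∀ j m, AddCommGroup (E j m)] [∀ j m, Module ℂ (E j m)] {i : Fin (k + 1)}

/-! ### The graph of the generators in terms of vectors -/

theorem idealGen_smul {β : Fin (k + 1) → ℕ} (hβ : Monotone β) (c d : ℂ) (q : Fin 2 → ℂ) {m : M}
    (v : Fib E m) :
    idealGen E β (c • q) (d • v) = (c ^ β (Fin.last k) * d) • idealGen E β q v := by
  funext j
  have h : c ^ β (Fin.last k) = c ^ (β (Fin.last k) - β j) * c ^ β j := by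
    rw [← pow_add, Nat.sub_add_cancel (hβ (Fin.le_last j))]
  simp only [idealGen, Pi.smul_apply, smul_smul, smul_eq_mul, mul_pow, h]
  congr 1
  ring

/-- Since the generators are bihomogeneous, membership in their graph can be read off from any
choice of homogeneous coordinates. -/
theorem exists_eq_smul_idealGen {β : Fin (k + 1) → ℕ} (hβ : Monotone β) {S : Set (PE F E)}
    {q : Fin 2 → ℂ} {hq : q ≠ 0} {z w : NonzeroVec F E}
    (h : (Projectivization.mk ℂ q hq, z.toPE, w.toPE) ∈ idealGraph F E β (Set.univ ×ˢ S)) :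
    z.toPE ∈ S ∧ ∃ (b : ℂ) (h : b • idealGen E β q z.vec ≠ 0),
      w = ⟨z.base, b • idealGen E β q z.vec, h⟩ := by
  obtain ⟨q', hq', m, v, hv, hg, ⟨-, hS⟩, heq⟩ := h
  simp only [Prod.mk.injEq] at heq
  obtain ⟨h₁, h₂, h₃⟩ := heq
  obtain ⟨c, rfl⟩ := (Projectivization.mk_eq_mk_iff ℂ _ _ hq' hq).1 h₁.symm
  obtain ⟨d, hd⟩ := NonzeroVec.toPE_eq_iff.1
    (show z.toPE = (⟨m, v, hv⟩ : NonzeroVec F E).toPE from h₂)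
  obtain ⟨b, rfl⟩ := NonzeroVec.toPE_eq_iff.1
    (show (⟨m, _, hg⟩ : NonzeroVec F E).toPE = w.toPE from h₃.symm)
  refine ⟨by rw [h₂]; exact hS, ?_⟩
  obtain ⟨m', v', hv'⟩ := z
  obtain rfl : m = m' := congrArg NonzeroVec.base hd
  obtain rfl : v = d • v' := by simpa using hd
  have key : (b • idealGen E β (c • q) (d • v') : Fib E m) =
      ((b : ℂ) * ((c : ℂ) ^ β (Fin.last k) * d)) • idealGen E β q v' := by
    simp only [Units.smul_def, idealGen_smul hβ, smul_smul]
  refine ⟨_, fun h => (smul_ne_zero_iff_ne b).2 hg (key.trans h), ?_⟩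
  congr 1

/-- The value of the generators at `z` is in the orbit of `z`, so that both have the same weighted
class. -/
theorem gtPart_ofVec_eq_weightedAction (hβ : StrictMono β) {q : Fin 2 → ℂ} (hq₀ : q 0 ≠ 0)
    (hq₁ : q 1 ≠ 0) {z : NonzeroVec F E} {b : ℂ} {h : b • idealGen E β q z.vec ≠ 0}
    (hz : z.vec i ≠ 0) (hw : (b • idealGen E β q z.vec) i ≠ 0) :
    (HomTot.ofVec (⟨z.base, b • idealGen E β q z.vec, h⟩ : NonzeroVec F E) hw).gtPart =
      (HomTot.ofVec z hz).gtPart.weightedAction β (Units.mk0 (q 1 / q 0) (div_ne_zero hq₁ hq₀)) := by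
  have hb : b ≠ 0 := fun hb => h (by rw [hb, zero_smul])
  rw [HomTot.weightedAction_gtPart_ofVec hβ.monotone, HomTot.gtPart_ofVec]
  apply HomTot.chart_injective
  rw [HomTot.chart_ofVec, HomTot.chart_ofVec]
  symm
  have hr : b * (q 0 ^ (β (Fin.last k) - β i) * q 1 ^ β i) ≠ 0 :=
    mul_ne_zero hb (mul_ne_zero (pow_ne_zero _ hq₀) (pow_ne_zero _ hq₁))
  refine NonzeroVec.toPE_eq_iff.2 ⟨Units.mk0 _ hr,
    (NonzeroVec.mk.injEq ..).mpr ⟨rfl, heq_of_eq (funext fun j => ?_)⟩⟩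
  simp only [geScalar, orbitScalar, idealGen, Units.smul_def, Pi.smul_apply, Units.val_mk0]
  by_cases hj : i ≤ j
  · rw [if_pos hj, if_pos hj, one_smul, smul_smul, smul_smul]
    congr 1
    have h₁ : β (Fin.last k) - β i = (β (Fin.last k) - β j) + (β j - β i) := by
      have h1 := hβ.monotone hj
      have h2 := hβ.monotone (Fin.le_last j)
      omega
    have h₂ : q 1 ^ β j = q 1 ^ β i * q 1 ^ (β j - β i) := by
      rw [← pow_add, Nat.add_sub_cancel' (hβ.monotone hj)]
    rw [h₁, h₂, pow_add, div_pow]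
    field_simp
  · rw [if_neg hj, if_neg hj, zero_smul, zero_smul, smul_zero]

end Graph

section Limits

variable {k : ℕ} {M : Type*} {F : Fin (k + 1) → Type*} {E : Fin (k + 1) → M → Type*}
  [∀ j m, AddCommGroup (E j m)] [∀ j m, Module ℂ (E j m)]
  [∀ j, TopologicalSpace (TotalSpace (F j) (E j))] [∀ j m, TopologicalSpace (E j m)]
  [TopologicalSpace M] [∀ j, NormedAddCommGroup (F j)] [∀ j, NormedSpace ℂ (F j)]
  [∀ j, FiberBundle (F j) (E j)] [∀ j, VectorBundle ℂ (F j) (E j)]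
  {i : Fin (k + 1)} {β : Fin (k + 1) → ℕ}

/-! ### Limits of the orbits -/

/-- A limit of points `([ε : 1], [z], [ε⁻¹ * z])` with `ε → 0` lies in the strict transform. The
orbit point `ε⁻¹ * z` is rescaled by `d ε ^ β_i`; then its components below `i` tend to zero, and
only the ones from `i` on have to be controlled. -/
theorem mem_strictTransform_of_tendsto (hβ : StrictMono β) {S : Set (PE F E)} {ι : Type*}
    {l : Filter ι} [l.NeBot] {m : M} {a b : Fib E m} (ha : a ≠ 0) (hb : b ≠ 0)
    {z : ι → NonzeroVec F E} {ε d : ι → ℂ} (hzS : ∀ n, (z n).toPE ∈ S)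
    (hzi : ∀ n, (z n).vec i ≠ 0) (hz : Tendsto z l (𝓝 ⟨m, a, ha⟩)) (hε : ∀ n, ε n ≠ 0)
    (hε0 : Tendsto ε l (𝓝 0)) (hd : ∀ n, d n ≠ 0) (hd1 : Tendsto d l (𝓝 1))
    (hlt : ∀ j, j < i → b j = 0)
    (hge : ∀ j, i ≤ j → Tendsto
      (fun n => coord F E m j (z n).base ((d n * (ε n)⁻¹ ^ (β j - β i)) • (z n).vec j)) l
      (𝓝 (coord F E m j m (b j)))) :
    (infinityP1, (⟨m, Projectivization.mk ℂ a ha⟩ : PE F E), ⟨m, Projectivization.mk ℂ b hb⟩) ∈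
      strictTransform F E β (Set.univ ×ˢ S) := by
  obtain ⟨hzb, hzc⟩ := tendsto_nonzeroVec_iff.1 hz
  have hq : ∀ n, (![ε n, 1] : Fin 2 → ℂ) ≠ 0 := fun n h => one_ne_zero (congrFun h 1)
  have hg : ∀ n, idealGen E β ![ε n, 1] (z n).vec ≠ 0 := fun n h => by
    have := congrFun h i
    simp only [idealGen, Matrix.cons_val_zero, Matrix.cons_val_one, one_pow, mul_one] at this
    exact smul_ne_zero (pow_ne_zero _ (hε n)) (hzi n) this
  -- The scalar that turns the value of the generators into the rescaled orbit point.
  let r : ι → ℂ := fun n => d n * (ε n)⁻¹ ^ (β (Fin.last k) - β i)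
  have hr : ∀ n, r n ≠ 0 := fun n => mul_ne_zero (hd n) (pow_ne_zero _ (inv_ne_zero (hε n)))
  let w : ι → NonzeroVec F E := fun n =>
    ⟨(z n).base, r n • idealGen E β ![ε n, 1] (z n).vec, smul_ne_zero (hr n) (hg n)⟩
  have hw : Tendsto w l (𝓝 ⟨m, b, hb⟩) := by
    refine tendsto_nonzeroVec_iff.2 ⟨hzb, fun j => ?_⟩
    rcases lt_or_ge j i with hj | hj
    · have h₁ : Tendsto (fun n => (d n * ε n ^ (β i - β j)) •
          coord F E m j (z n).base ((z n).vec j)) l (𝓝 (((1 : ℂ) * 0 ^ (β i - β j)) •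
          coord F E m j m (a j))) := (hd1.mul (hε0.pow _)).smul (hzc j)
      rw [zero_pow (Nat.sub_ne_zero_of_lt (hβ hj)), mul_zero, zero_smul] at h₁
      change Tendsto _ l (𝓝 (coord F E m j m (b j)))
      rw [hlt j hj, map_zero]
      refine h₁.congr fun n => ?_
      rw [← map_smul]
      congr 1
      simp only [w, r, idealGen, Pi.smul_apply, smul_smul, Matrix.cons_val_zero,
        Matrix.cons_val_one, one_pow, mul_one]
      congr 1
      have : β (Fin.last k) - β j = (β (Fin.last k) - β i) + (β i - β j) := by
        have h1 := hβ hj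
        have h2 := hβ.monotone (Fin.le_last i)
        omega
      rw [this, pow_add, inv_pow]
      field_simp [hε n]
    · refine (hge j hj).congr fun n => ?_
      congr 1
      simp only [w, r, idealGen, Pi.smul_apply, smul_smul, Matrix.cons_val_zero,
        Matrix.cons_val_one, one_pow, mul_one]
      congr 1
      have : β (Fin.last k) - β i = (β (Fin.last k) - β j) + (β j - β i) := by
        have h1 := hβ.monotone hj
        have h2 := hβ.monotone (Fin.le_last j)
        omega
      rw [this, pow_add, inv_pow, inv_pow]
      field_simp [hε n]
  have hqt : Tendsto (fun n => Projectivization.mk ℂ ![ε n, 1] (hq n)) l (𝓝 infinityP1) := by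
    have h0 : (![0, 1] : Fin 2 → ℂ) ≠ 0 := fun h => one_ne_zero (congrFun h 1)
    have : Tendsto (fun n => (⟨![ε n, 1], hq n⟩ : {q : Fin 2 → ℂ // q ≠ 0})) l
        (𝓝 ⟨![0, 1], h0⟩) := by
      rw [tendsto_subtype_rng, tendsto_pi_nhds]
      intro j
      fin_cases j
      · exact hε0
      · exact tendsto_const_nhds
    exact (continuous_mk'_P1.tendsto _).comp this
  refine mem_closure_of_tendsto (hqt.prodMk_nhds
    (((NonzeroVec.continuous_toPE.tendsto _).comp hz).prodMk_nhds
      ((NonzeroVec.continuous_toPE.tendsto _).comp hw))) (Eventually.of_forall fun n => ?_)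
  refine ⟨_, hq n, (z n).base, (z n).vec, (z n).ne_zero, hg n, ⟨trivial, hzS n⟩, ?_⟩
  refine Prod.ext rfl (Prod.ext rfl ?_)
  exact congrArg (PE.mk (z n).base)
    ((Projectivization.mk_eq_mk_iff' ℂ _ _ _ _).2 ⟨r n, rfl⟩)

/-- The exceptional divisor consists of points of the strict transform over `[0 : 1]`. -/
theorem mem_strictTransform_of_mem_affineCone (hβ : StrictMono β) {S : Set (PE F E)}
    {x y : HomTot F E i} (h : (x, y) ∈ affineCone β (HomTot.chart ⁻¹' S))
    (hx : x ∈ homLt F E i) :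
    (infinityP1, x.chart, y.chart) ∈ strictTransform F E β (Set.univ ×ˢ S) := by
  obtain ⟨hxS, hyGt, hproj, hy⟩ := h
  dsimp only at hxS hyGt hproj hy
  obtain ⟨m, a, b, ha, hb, hai, hbi, hab, rfl, rfl⟩ := HomTot.exists_eq_ofVec_of_proj_eq hproj
  have hagt : ∀ j, i < j → a j = 0 := HomTot.ofVec_mem_homLt.1 hx
  have hblt : ∀ j, j < i → b j = 0 := HomTot.ofVec_mem_homGt.1 hyGt
  have haS : (⟨m, a, ha⟩ : NonzeroVec F E).toPE ∈ S := by rwa [Set.mem_preimage,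
    HomTot.chart_ofVec] at hxS
  rw [HomTot.chart_ofVec, HomTot.chart_ofVec]
  rcases hy with hy | ⟨h, hy⟩
  · -- Over the zero section the point is a limit along a single orbit.
    have hb0 := HomTot.ofVec_hom_eq_zero_iff.1 hy
    refine mem_strictTransform_of_tendsto (i := i) (l := atTop) (z := fun _ : ℕ => ⟨m, a, ha⟩)
      (ε := fun n : ℕ => 1 / ((n : ℂ) + 1)) (d := fun _ => 1) hβ ha hb (fun _ => haS)
      (fun _ => hai) tendsto_const_nhds (fun n => one_div_ne_zero (Nat.cast_add_one_ne_zero n))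
      (tendsto_one_div_add_atTop_nhds_zero_nat (𝕜 := ℂ)) (fun _ => one_ne_zero)
      tendsto_const_nhds hblt fun j hj => ?_
    rcases hj.eq_or_lt with rfl | hj
    · simp [hab]
    · simp [hagt j hj, show b j = 0 from hb0 j hj.ne']
  · -- Off the zero section, lift the approximating pairs to vectors.
    have h₁ := mem_closure_of_mem_weightedStrictTransform hy
    have ho := (HomTot.isOpenQuotientMap_ofVec (F := F) (E := E) (i := i)).isOpenMap
    let a' : {z : NonzeroVec F E // z.vec i ≠ 0} := ⟨⟨m, a, ha⟩, hai⟩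
    let b' : {z : NonzeroVec F E // z.vec i ≠ 0} := ⟨⟨m, b, hb⟩, hbi⟩
    have h₂ : (a', b') ∈ closure (Prod.map _ _ ⁻¹' _) :=
      (ho.prodMap ho).preimage_closure_subset_closure_preimage h₁
    -- `P` is the set of these lifts; it serves as the index set of the limits below.
    obtain ⟨P, hP⟩ : ∃ P, P = Prod.map
        (fun z : {z : NonzeroVec F E // z.vec i ≠ 0} => HomTot.ofVec z.1 z.2)
        (fun z : {z : NonzeroVec F E // z.vec i ≠ 0} => HomTot.ofVec z.1 z.2) ⁻¹'
        {p : HomTot F E i × HomTot F E i | p.1 ∈ HomTot.chart ⁻¹' S ∧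
          ∃ c : ℂˣ, p.2 = p.1.gtPart.weightedAction β c} := ⟨_, rfl⟩
    rw [← hP, mem_closure_iff_comap_neBot] at h₂
    have hval : Tendsto (Subtype.val : P → _) (comap Subtype.val (𝓝 (a', b'))) (𝓝 (a', b')) :=
      tendsto_comap
    have hz : Tendsto (fun n : P => n.1.1.1) (comap Subtype.val (𝓝 (a', b'))) (𝓝 ⟨m, a, ha⟩) :=
      ((continuous_subtype_val.comp continuous_fst).tendsto (a', b')).comp hval
    have hw : Tendsto (fun n : P => n.1.2.1) (comap Subtype.val (𝓝 (a', b'))) (𝓝 ⟨m, b, hb⟩) :=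
      ((continuous_subtype_val.comp continuous_snd).tendsto (a', b')).comp hval
    have hPd : ∀ n : P, n.1.1.1.toPE ∈ S ∧ ∃ (c d : ℂˣ),
        ∀ j, coord F E m j n.1.2.1.base (n.1.2.1.vec j) =
          ((d : ℂ) * orbitScalar β i c j) • coord F E m j n.1.1.1.base (n.1.1.1.vec j) := by
      rintro ⟨⟨⟨z, hz⟩, ⟨w, hw⟩⟩, hn⟩
      rw [hP] at hn
      obtain ⟨hn₁, c, hc⟩ := hn
      refine ⟨by simpa using hn₁, c, ?_⟩
      dsimp only [Prod.map] at hc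
      rw [HomTot.weightedAction_gtPart_ofVec hβ.monotone] at hc
      have hc' := congrArg HomTot.chart hc
      rw [HomTot.chart_ofVec, HomTot.chart_ofVec] at hc'
      obtain ⟨d, hd⟩ := NonzeroVec.toPE_eq_iff.1 hc'.symm
      refine ⟨d, fun j => ?_⟩
      refine (congrArg (fun w : NonzeroVec F E => coord F E m j w.base (w.vec j)) hd).trans ?_
      simp [mul_smul, Units.smul_def]
    choose hzS c d hcd using hPd
    obtain ⟨-, hzc⟩ := tendsto_nonzeroVec_iff.1 hz
    obtain ⟨-, hwc⟩ := tendsto_nonzeroVec_iff.1 hw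
    -- The `i`-th components have the same nonzero limit, so that the scalars `d` tend to `1`.
    have hd1 : Tendsto (fun n => (d n : ℂ)) (comap Subtype.val (𝓝 (a', b'))) (𝓝 1) := by
      have h₀ := hwc i
      simp only [hcd, orbitScalar_self, mul_one] at h₀
      obtain ⟨γ, hγ, hγe⟩ := exists_tendsto_of_tendsto_smul (mt coord_self_eq_zero_iff.1 hai)
        (hzc i) h₀
      have hab' : γ • coord F E m i m (a i) = (1 : ℂ) • coord F E m i m (a i) := by
        rw [one_smul]
        exact hγe.trans (congrArg _ hab.symm)
      rwa [smul_left_injective ℂ (mt coord_self_eq_zero_iff.1 hai) hab'] at hγ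
    -- Some component of weight `N > 0` has a nonzero limit after the action, but tends to zero
    -- before, so that `c` tends to infinity.
    have hε0 : Tendsto (fun n => (c n : ℂ)⁻¹) (comap Subtype.val (𝓝 (a', b'))) (𝓝 0) := by
      obtain ⟨j, hji, hj⟩ : ∃ j, j ≠ i ∧ b j ≠ 0 := by
        by_contra! H
        exact h.2 (HomTot.ofVec_hom_eq_zero_iff.2 H)
      have hij : i < j := lt_of_le_of_ne (not_lt.1 fun h => hj (hblt j h)) hji.symm
      have h₀ : Tendsto (fun n : P => ((c n : ℂ)⁻¹ ^ (β j - β i)) •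
          coord F E m j n.1.2.1.base (n.1.2.1.vec j)) (comap Subtype.val (𝓝 (a', b'))) (𝓝 0) := by
        have h₁ := hd1.smul (hzc j)
        rw [show coord F E m j m (a j) = 0 by rw [hagt j hij, map_zero], smul_zero] at h₁
        refine h₁.congr fun n => ?_
        rw [hcd, smul_smul, orbitScalar, if_pos hij.le, inv_pow, mul_left_comm,
          inv_mul_cancel₀ (pow_ne_zero _ (c n).ne_zero), mul_one]
      obtain ⟨γ, hγ, hγe⟩ := exists_tendsto_of_tendsto_smul (mt coord_self_eq_zero_iff.1 hj)
        (hwc j) h₀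
      rw [(smul_eq_zero.1 hγe).resolve_right (mt coord_self_eq_zero_iff.1 hj)] at hγ
      exact tendsto_zero_of_tendsto_pow_zero hγ
    refine mem_strictTransform_of_tendsto (i := i) hβ ha hb hzS (fun n => n.1.1.2) hz
      (fun n => inv_ne_zero (c n).ne_zero) hε0 (fun n => (d n).ne_zero) hd1 hblt fun j hj => ?_
    refine (hwc j).congr fun n => ?_
    rw [hcd, map_smul, inv_inv, orbitScalar, if_pos hj]

end Limits

section Sets

variable {k : ℕ} {M : Type*} {F : Fin (k + 1) → Type*} {E : Fin (k + 1) → M → Type*}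
  [∀ j m, AddCommGroup (E j m)] [∀ j m, Module ℂ (E j m)] {i : Fin (k + 1)}

/-! ### The sets over the chart domain -/

theorem HomTot.chart_mem_chartDomain (x : HomTot F E i) : x.chart ∈ chartDomain F E i := by
  obtain ⟨z, h, rfl⟩ := x.exists_eq_ofVec'
  rw [HomTot.chart_ofVec]
  exact toPE_mem_chartDomain.2 h

theorem stableUnstable_eq_inter_cInfty :
    stableUnstable F E i = (chartDomain F E i ×ˢ chartDomain F E i) ∩ cInfty F E i := by
  ext ⟨x, y⟩
  constructor
  · rintro ⟨m, a, b, ha, hb, hai, hbi, hxy, hagt, hblt, hab⟩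
    obtain ⟨rfl, rfl⟩ := Prod.mk.inj hxy
    refine ⟨⟨⟨m, a, ha, rfl, hai⟩, ⟨m, b, hb, rfl, hbi⟩⟩, m, a, b, ha, hb, rfl, hagt, hblt, ?_⟩
    obtain ⟨c, hc⟩ := (Projectivization.mk_eq_mk_iff' ℂ _ _ _ _).1 hab
    rw [LinearIndependent.pair_iff]
    intro H
    exact one_ne_zero (H 1 (-c) (by rw [← hc]; simp)).1
  · rintro ⟨⟨hx, hy⟩, m, a, b, ha, hb, hxy, hagt, hblt, hab⟩
    obtain ⟨rfl, rfl⟩ := Prod.mk.inj hxy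
    have hai : a i ≠ 0 := toPE_mem_chartDomain (z := ⟨m, a, ha⟩).1 hx
    have hbi : b i ≠ 0 := toPE_mem_chartDomain (z := ⟨m, b, hb⟩).1 hy
    refine ⟨m, a, b, ha, hb, hai, hbi, rfl, hagt, hblt, ?_⟩
    rw [LinearIndependent.pair_iff' hai] at hab
    push Not at hab
    obtain ⟨c, hc⟩ := hab
    exact ((Projectivization.mk_eq_mk_iff' ℂ _ _ _ _).2 ⟨c, hc⟩).symm

variable [∀ j, TopologicalSpace (TotalSpace (F j) (E j))] {β : Fin (k + 1) → ℕ}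

theorem exceptionalDivisor_inter_chartDomain (S : Set (PE F E)) :
    exceptionalDivisor β i (S ∩ chartDomain F E i) =
      Prod.map HomTot.chart HomTot.chart ''
        (affineCone β (HomTot.chart ⁻¹' S) ∩ {p | p.1 ∈ homLt F E i}) := by
  have : (HomTot.chart ⁻¹' (S ∩ chartDomain F E i) : Set (HomTot F E i)) = HomTot.chart ⁻¹' S :=
    Set.ext fun x => and_iff_left x.chart_mem_chartDomain
  rw [exceptionalDivisor, this]

theorem mem_of_mem_strictTransform {S : Set (PE F E)} (hS : IsClosed S)
    {p : ℙ ℂ (Fin 2 → ℂ) × PE F E × PE F E}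
    (h : p ∈ strictTransform F E β (Set.univ ×ˢ S)) : p.2.1 ∈ S := by
  refine closure_minimal ?_ (hS.preimage (continuous_fst.comp continuous_snd)) h
  rintro _ ⟨q, hq, m, v, hv, hg, ⟨-, hvS⟩, rfl⟩
  exact hvS

end Sets

section Equality

variable {k : ℕ} {M : Type*} {F : Fin (k + 1) → Type*} {E : Fin (k + 1) → M → Type*}
  [∀ j m, AddCommGroup (E j m)] [∀ j m, Module ℂ (E j m)]
  [∀ j, TopologicalSpace (TotalSpace (F j) (E j))] [∀ j m, TopologicalSpace (E j m)]
  [TopologicalSpace M] [∀ j, NormedAddCommGroup (F j)] [∀ j, NormedSpace ℂ (F j)]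
  [∀ j, FiberBundle (F j) (E j)] [∀ j, VectorBundle ℂ (F j) (E j)]
  {i : Fin (k + 1)} {β : Fin (k + 1) → ℕ}

/-! ### Comparison of the strict transform with the affine cone -/

/-- Points of the strict transform over `[0 : 1]` and `S(F_i) ×_{F_i} U(F_i)` lie in the affine
cone. -/
theorem mem_affineCone_of_mem_strictTransform (hβ : StrictMono β) {S : Set (PE F E)}
    (hS : IsClosed S) {m : M} {a b : Fib E m} {ha : a ≠ 0} {hb : b ≠ 0} {hai : a i ≠ 0}
    {hbi : b i ≠ 0} (hblt : ∀ j, j < i → b j = 0)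
    (hab : Projectivization.mk ℂ (a i) hai = Projectivization.mk ℂ (b i) hbi)
    (h : (infinityP1, (⟨m, Projectivization.mk ℂ a ha⟩ : PE F E), ⟨m, Projectivization.mk ℂ b hb⟩) ∈
      strictTransform F E β (Set.univ ×ˢ S)) :
    (HomTot.ofVec (⟨m, a, ha⟩ : NonzeroVec F E) hai,
      HomTot.ofVec (⟨m, b, hb⟩ : NonzeroVec F E) hbi) ∈ affineCone β (HomTot.chart ⁻¹' S) := by
  have hGt : HomTot.ofVec (⟨m, b, hb⟩ : NonzeroVec F E) hbi ∈ homGt F E i :=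
    HomTot.ofVec_mem_homGt.2 hblt
  refine ⟨?_, hGt, ?_, or_iff_not_imp_left.2 fun hne => ⟨⟨hGt, hne⟩, ?_⟩⟩
  · rw [Set.mem_preimage, HomTot.chart_ofVec]
    exact mem_of_mem_strictTransform hS h
  · exact congrArg (Sigma.mk m) hab
  obtain ⟨j₀, hji, hj₀⟩ : ∃ j, j ≠ i ∧ b j ≠ 0 := by
    by_contra! H
    exact hne (HomTot.ofVec_hom_eq_zero_iff.2 H)
  have hij : i < j₀ := lt_of_le_of_ne (not_lt.1 fun h => hj₀ (hblt _ h)) hji.symm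
  -- Lift to vectors on the open set where the relevant components do not vanish.
  let Q := {q : {q : Fin 2 → ℂ // q ≠ 0} // q.1 1 ≠ 0}
  let N := {z : NonzeroVec F E // z.vec i ≠ 0}
  let N' := {z : NonzeroVec F E // z.vec i ≠ 0 ∧ z.vec j₀ ≠ 0}
  have hQo : IsOpenMap fun q : Q => Projectivization.mk' ℂ q.1 :=
    isOpenMap_mk'_P1.comp (IsOpen.isOpenMap_subtype_val (isOpen_ne_fun
      ((continuous_apply 1).comp continuous_subtype_val) continuous_const))
  have hNo : IsOpenMap fun z : N => z.1.toPE :=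
    NonzeroVec.isOpenMap_toPE.comp (isOpen_setOf_apply_ne_zero i).isOpenMap_subtype_val
  have hNo' : IsOpenMap fun z : N' => z.1.toPE :=
    NonzeroVec.isOpenMap_toPE.comp (((isOpen_setOf_apply_ne_zero i).inter
      (isOpen_setOf_apply_ne_zero j₀)).isOpenMap_subtype_val)
  let p : Q × N × N' := (⟨⟨![0, 1], fun h => one_ne_zero (congrFun h 1)⟩, one_ne_zero⟩,
    ⟨⟨m, a, ha⟩, hai⟩, ⟨⟨m, b, hb⟩, hbi, hj₀⟩)
  have hp : p ∈ closure (Prod.map _ (Prod.map _ _) ⁻¹' idealGraph F E β (Set.univ ×ˢ S)) :=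
    (hQo.prodMap (hNo.prodMap hNo')).preimage_closure_subset_closure_preimage h
  have hgt : ∀ w : N', (HomTot.ofVec w.1 w.2.1).gtPart ∈ homGt F E i ∧
      (HomTot.ofVec w.1 w.2.1).gtPart.hom ≠ 0 := fun w => by
    refine ⟨HomTot.gtPart_mem_homGt _, ?_⟩
    rw [HomTot.gtPart_ofVec]
    intro H
    refine w.2.2 ?_
    simpa [geScalar, hij.le] using HomTot.ofVec_hom_eq_zero_iff.1 H j₀ hji
  let ψ : Q × N × N' → HomTot F E i × WeightedProj F E β i := fun p =>
    (HomTot.ofVec p.2.1.1 p.2.1.2, Quot.mk _ ⟨_, hgt p.2.2⟩)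
  have hψ : Continuous ψ := by
    have hc := (HomTot.isOpenQuotientMap_ofVec (F := F) (E := E) (i := i)).continuous
    refine (hc.comp (continuous_fst.comp continuous_snd)).prodMk
      (continuous_coinduced_rng.comp (Continuous.subtype_mk ?_ _))
    have hι : Continuous fun w : N' => (⟨w.1, w.2.1⟩ : N) := continuous_subtype_val.subtype_mk _
    exact HomTot.continuous_gtPart.comp
      ((hc.comp hι).comp (continuous_snd.comp continuous_snd))
  have hlim : ψ p = (HomTot.ofVec (⟨m, a, ha⟩ : NonzeroVec F E) hai,
      Quot.mk _ ⟨HomTot.ofVec (⟨m, b, hb⟩ : NonzeroVec F E) hbi, hGt, hne⟩) := by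
    refine Prod.ext rfl (congrArg (Quot.mk _) (Subtype.ext ?_))
    change (HomTot.ofVec (⟨m, b, hb⟩ : NonzeroVec F E) hbi).gtPart = _
    rw [HomTot.gtPart_ofVec]
    congr 1
    refine (NonzeroVec.mk.injEq ..).mpr ⟨rfl, heq_of_eq (funext fun j => ?_)⟩
    by_cases hj : i ≤ j
    · simp [geScalar, hj]
    · simp [hblt j (not_le.1 hj)]
  rw [← hlim]
  refine map_mem_closure hψ hp ?_
  rintro ⟨⟨⟨q, hq⟩, hq₁⟩, ⟨z, hz⟩, ⟨w, hwi, hwj⟩⟩ hG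
  obtain ⟨hzS, c, hc, rfl⟩ := exists_eq_smul_idealGen hβ.monotone hG
  -- Over `[0 : 1]` itself only the last generator survives, but `i < j₀` is not the last index.
  have hq₀ : q 0 ≠ 0 := fun h0 => hwi <| by
    have : β (Fin.last k) - β i ≠ 0 :=
      Nat.sub_ne_zero_of_lt (hβ (hij.trans_le (Fin.le_last j₀)))
    simp [idealGen, h0, this]
  have hact := gtPart_ofVec_eq_weightedAction hβ hq₀ hq₁ (h := hc) hz hwi
  refine ⟨HomTot.ofVec z hz, by rwa [Set.mem_preimage, HomTot.chart_ofVec],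
    ⟨HomTot.gtPart_mem_homGt _, fun h0 => ?_⟩, Prod.ext rfl (Quot.sound ⟨_, hact⟩).symm⟩
  refine (hgt ⟨⟨z.base, c • idealGen E β q z.vec, hc⟩, hwi, hwj⟩).2 ?_
  rw [hact]
  exact (congrArg (weightMap E β i z.base _ ∘ₗ ·) h0).trans (LinearMap.comp_zero _)

/-- The strict transform of `ℙ¹ × S`, for any closed `S`, meets `{[0 : 1]} × S(F_i) ×_{F_i} U(F_i)`
in the exceptional divisor of the affine cone. -/
theorem strictTransform_inter_stableUnstable (hβ : StrictMono β) {S : Set (PE F E)}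
    (hS : IsClosed S) :
    strictTransform F E β (Set.univ ×ˢ S) ∩ ({infinityP1} ×ˢ stableUnstable F E i) =
      {infinityP1} ×ˢ exceptionalDivisor β i (S ∩ chartDomain F E i) := by
  rw [exceptionalDivisor_inter_chartDomain]
  ext ⟨q, x, y⟩
  constructor
  · rintro ⟨h, rfl, m, a, b, ha, hb, hai, hbi, hxy, hagt, hblt, hab⟩
    obtain ⟨rfl, rfl⟩ := Prod.mk.inj hxy
    refine ⟨rfl, _, ⟨mem_affineCone_of_mem_strictTransform hβ hS (hai := hai) (hbi := hbi)
      hblt hab h, HomTot.ofVec_mem_homLt.2 hagt⟩, ?_⟩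
    rw [Prod.map_apply, HomTot.chart_ofVec, HomTot.chart_ofVec]
    rfl
  · rintro ⟨rfl, ⟨x, y⟩, ⟨hc, hx⟩, hxy⟩
    obtain ⟨rfl, rfl⟩ := Prod.mk.inj hxy
    refine ⟨mem_strictTransform_of_mem_affineCone hβ hc hx, rfl, ?_⟩
    obtain ⟨-, hy, hproj, -⟩ := hc
    dsimp only at hy hproj hx
    obtain ⟨m, a, b, ha, hb, hai, hbi, hab, rfl, rfl⟩ :=
      HomTot.exists_eq_ofVec_of_proj_eq hproj
    refine ⟨m, a, b, ha, hb, hai, hbi, ?_, HomTot.ofVec_mem_homLt.1 hx,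
      HomTot.ofVec_mem_homGt.1 hy, ?_⟩
    · simp only [HomTot.chart_ofVec]
      rfl
    · simp only [hab]

/-! ### Density in `C_i^∞` -/

variable (F) in
/-- Two linearly dependent vectors of a fibre lie on a common line. -/
theorem exists_smul_eq_smul_eq {j : Fin (k + 1)} [Nontrivial (F j)] {m : M} {x y : E j m}
    (h : ¬ LinearIndependent ℂ ![x, y]) : ∃ u : E j m, u ≠ 0 ∧ ∃ c d : ℂ, x = c • u ∧ y = d • u := by
  by_cases hx : x = 0
  · subst hx
    by_cases hy : y = 0
    · have : Nontrivial (E j m) := ((trivializationAt (F j) (E j) m).continuousLinearEquivAt ℂ m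
        (FiberBundle.mem_baseSet_trivializationAt' m)).toEquiv.nontrivial
      obtain ⟨u, hu⟩ := exists_ne (0 : E j m)
      exact ⟨u, hu, 0, 0, by simp, by simp [hy]⟩
    · exact ⟨y, hy, 0, 1, by simp, by simp⟩
  · rw [LinearIndependent.pair_iff' hx] at h
    push Not at h
    obtain ⟨c, hc⟩ := h
    exact ⟨x, hx, 1, c, by simp, hc.symm⟩

theorem cInfty_subset_closure_stableUnstable [Nontrivial (F i)] :
    cInfty F E i ⊆ closure (stableUnstable F E i) := by
  rintro _ ⟨m, a, b, ha, hb, rfl, hagt, hblt, hab⟩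
  obtain ⟨u, hu, c, d, hc, hd⟩ := exists_smul_eq_smul_eq F hab
  -- Move both `i`-th components by `ε u`, avoiding the two values of `ε` where one of them vanishes.
  let D : Set ℂ := {-c, -d}ᶜ
  have hD : (0 : ℂ) ∈ closure D := (Set.toFinite {-c, -d}).countable.dense_compl ℂ 0
  rw [mem_closure_iff_comap_neBot] at hD
  have hε : Tendsto (Subtype.val : D → ℂ) (comap Subtype.val (𝓝 0)) (𝓝 0) := tendsto_comap
  have key : ∀ (v : Fib E m) (hv : v ≠ 0) (e : ℂ), v i = e • u → (∀ ε : D, e + ε.1 ≠ 0) →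
      ∃ v' : D → Fib E m, (∀ ε, v' ε i = (e + ε.1) • u) ∧ (∀ ε j, j ≠ i → v' ε j = v j) ∧
        ∃ hv' : ∀ ε, v' ε ≠ 0, Tendsto (fun ε => (⟨m, Projectivization.mk ℂ _ (hv' ε)⟩ : PE F E))
          (comap Subtype.val (𝓝 0)) (𝓝 ⟨m, Projectivization.mk ℂ v hv⟩) := by
    intro v hv e he hD
    let t : Fib E m := Pi.single i u
    have hi : ∀ ε : D, (v + ε.1 • t : Fib E m) i = (e + ε.1) • u := fun ε => by
      simp [t, he, add_smul]
    have hv' : ∀ ε : D, (v + ε.1 • t : Fib E m) ≠ 0 := fun ε h0 =>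
      smul_ne_zero (hD ε) hu ((hi ε).symm.trans (congrFun h0 i))
    refine ⟨fun ε => v + ε.1 • t, hi, fun ε j hj => by simp [t, hj], hv', ?_⟩
    have : Tendsto (fun ε : D => (⟨m, _, hv' ε⟩ : NonzeroVec F E)) (comap Subtype.val (𝓝 0))
        (𝓝 ⟨m, v, hv⟩) := by
      refine tendsto_nonzeroVec_iff.2 ⟨tendsto_const_nhds, fun j => ?_⟩
      have h := (hε.smul_const (coord F E m j m (t j))).const_add
        (coord F E m j m (v j))
      rw [zero_smul, add_zero] at h
      simpa using h
    exact (NonzeroVec.continuous_toPE.tendsto _).comp this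
  have hne : ∀ ε : D, c + ε.1 ≠ 0 ∧ d + ε.1 ≠ 0 := by
    rintro ⟨ε, hε⟩
    simp only [D, Set.mem_compl_iff, Set.mem_insert_iff, Set.mem_singleton_iff, not_or] at hε
    exact ⟨fun h => hε.1 (eq_neg_of_add_eq_zero_right h),
      fun h => hε.2 (eq_neg_of_add_eq_zero_right h)⟩
  obtain ⟨a', hai, haj, ha', hat⟩ := key a ha c hc fun ε => (hne ε).1
  obtain ⟨b', hbi, hbj, hb', hbt⟩ := key b hb d hd fun ε => (hne ε).2
  refine mem_closure_of_tendsto (hat.prodMk_nhds hbt) (Eventually.of_forall fun ε => ?_)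
  have hai' : a' ε i ≠ 0 := hai ε ▸ smul_ne_zero (hne ε).1 hu
  have hbi' : b' ε i ≠ 0 := hbi ε ▸ smul_ne_zero (hne ε).2 hu
  refine ⟨m, a' ε, b' ε, ha' ε, hb' ε, hai', hbi', rfl,
    fun j hj => (haj ε j hj.ne').trans (hagt j hj),
    fun j hj => (hbj ε j hj.ne).trans (hblt j hj),
    (Projectivization.mk_eq_mk_iff' ℂ _ _ _ _).2 ⟨(c + ε.1) / (d + ε.1), ?_⟩⟩
  rw [hai, hbi, smul_smul, div_mul_cancel₀ _ (hne ε).2]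

end Equality

end WeightedBlowup

theorem mainTheorem12 {k : ℕ} {EM : Type*} [NormedAddCommGroup EM] [NormedSpace ℂ EM]
    [FiniteDimensional ℂ EM]
    {M : Type*} [TopologicalSpace M] [T2Space M] [ChartedSpace EM M] [IsManifold 𝓘(ℂ, EM) ω M]
    (F : Fin (k + 1) → Type*) [∀ j, NormedAddCommGroup (F j)] [∀ j, NormedSpace ℂ (F j)]
    [∀ j, FiniteDimensional ℂ (F j)] [∀ j, Nontrivial (F j)]
    (E : Fin (k + 1) → M → Type*) [∀ j m, AddCommGroup (E j m)] [∀ j m, Module ℂ (E j m)]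
    [∀ j m, TopologicalSpace (E j m)] [∀ j, TopologicalSpace (TotalSpace (F j) (E j))]
    [∀ j, FiberBundle (F j) (E j)] [∀ j, VectorBundle ℂ (F j) (E j)]
    [∀ j, ContMDiffVectorBundle ω (F j) (E j) 𝓘(ℂ, EM)]
    (β : Fin (k + 1) → ℕ) (hβ₀ : β 0 = 0) (hβ : StrictMono β)
    (s : ∀ m, ℙ ℂ (WeightedBlowup.Fib E m))
    (hs : WeightedBlowup.IsHolomorphicSection (EM := EM) F E s) (i : Fin (k + 1)) :
    ((∃ O : Set (WeightedBlowup.PE F E × WeightedBlowup.PE F E), IsOpen O ∧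
        WeightedBlowup.stableUnstable F E i = O ∩ WeightedBlowup.cInfty F E i) ∧
      WeightedBlowup.cInfty F E i ⊆ closure (WeightedBlowup.stableUnstable F E i)) ∧
    WeightedBlowup.sTilde F E β s ∩
        ({WeightedBlowup.infinityP1} ×ˢ WeightedBlowup.stableUnstable F E i) =
      {WeightedBlowup.infinityP1} ×ˢ
        WeightedBlowup.exceptionalDivisor β i
          (WeightedBlowup.sectionImage F E s ∩ WeightedBlowup.chartDomain F E i) ∧
    WeightedBlowup.sTildeInfty F E β s i ∩
        (WeightedBlowup.chartDomain F E i ×ˢ WeightedBlowup.chartDomain F E i) =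
      WeightedBlowup.exceptionalDivisor β i
        (WeightedBlowup.sectionImage F E s ∩ WeightedBlowup.chartDomain F E i) := by
  have h₀ := WeightedBlowup.stableUnstable_eq_inter_cInfty (F := F) (E := E) (i := i)
  have h₁ := WeightedBlowup.strictTransform_inter_stableUnstable (F := F) (E := E) (i := i) hβ
    (WeightedBlowup.isClosed_sectionImage hs)
  have ho := WeightedBlowup.isOpen_chartDomain (F := F) (E := E) i
  refine ⟨⟨⟨_, ho.prod ho, h₀⟩,
    WeightedBlowup.cInfty_subset_closure_stableUnstable⟩, h₁, ?_⟩
  -- The second equality is the first one, projected: cut down to the chart domain, `C_i^∞` becomes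
  -- `S(F_i) ×_{F_i} U(F_i)`.
  ext p
  constructor
  · rintro ⟨⟨⟨q, p⟩, ⟨hp, rfl, hpC⟩, rfl⟩, hpD⟩
    have hpS : p ∈ WeightedBlowup.stableUnstable F E i := h₀.symm ▸ ⟨hpD, hpC⟩
    exact (h₁.subset ⟨hp, rfl, hpS⟩).2
  · intro hp
    obtain ⟨hpT, -, hpS⟩ := h₁.superset (show (WeightedBlowup.infinityP1, p) ∈ _ from ⟨rfl, hp⟩)
    have hp' := h₀.subset hpS
    exact ⟨⟨_, ⟨hpT, rfl, hp'.2⟩, rfl⟩, hp'.1⟩
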